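/- Let $p$ be a prime and let $G$ be a finite $p$-group whose derived subgroup $G'$ has index $|G:G'| = p^2$. If $G$ has an irreducible complex character of degree greater than $p$, then $G$ has an irreducible complex character $\chi$ with $p < \chi(1) \le p^{\frac{p+1}{2}}$. -/

import Mathlib

/-- `χ` is an irreducible (complex) character of `G`: the character, i.e. the trace function, of an
irreducible finite-dimensional complex representation of `G`. (Every finite-dimensional complex
space is isomorphic to one in `Type`, so the universe of `V` is no restriction.) -/
def IsIrreducibleCharacter {G : Type*} [Group G] (χ : G → ℂ) : Prop :=
  ∃ (V : Type) (_ : AddCommGroup V) (_ : Module ℂ V) (_ : FiniteDimensional ℂ V)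
    (ρ : Representation ℂ G V), ρ.IsIrreducible ∧ χ = ρ.character

/-- The set of degrees `χ 1` of the irreducible complex characters `χ` of `G`. -/
def irreducibleCharacterDegrees (G : Type*) [Group G] : Set ℕ :=
  {n | ∃ χ : G → ℂ, IsIrreducibleCharacter χ ∧ χ 1 = (n : ℂ)}

/-! Induction on |G|, with two inputs: every irreducible degree is at most the index of an abelian
subgroup, and degrees of quotients are degrees of G. If p = 2, then G has a cyclic subgroup of index
at most 2 and no degree exceeds 2, so p is odd. Take Z ≤ G' central of order p. If G/Z has a degree
above p, induction applies. Otherwise all degrees of G/Z are at most p, and every degree of G is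
shown to satisfy the bound, in two cases.

If G/Z has an abelian maximal subgroup, its preimage A satisfies A' ≤ Z. The quotient A/Z(A) is
elementary abelian with |A : Z(A)| ≤ p^p (`card_le_pow_of_index_commutator_dvd`), and the commutator
pairing yields an abelian B ≤ A with |A : B|² ≤ |A : Z(A)|
(`exists_isMulCommutative_index_le_relIndex_center`).

If not, G/Z has class at most 3 (`commutator_commutator_le_center_of_degrees_le`): a representation
of degree at most p kills M' for some maximal M, and this forces the subgroups M' to be central.
Then G' is abelian of index at most p². -/

open Representation
open scoped commutatorElement

/-! ### Irreducible representations and abelian subgroups. -/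

namespace Representation

variable {G V : Type*} [Group G] [AddCommGroup V] [Module ℂ V]

theorem isIrreducible_iff_forall_submodule (ρ : Representation ℂ G V) :
    ρ.IsIrreducible ↔ Nontrivial V ∧
      ∀ W : Submodule ℂ V, (∀ g, ∀ v ∈ W, ρ g v ∈ W) → W = ⊥ ∨ W = ⊤ := by
  constructor
  · intro h
    refine ⟨?_, fun W hW => ?_⟩
    · by_contra hV
      rw [not_nontrivial_iff_subsingleton] at hV
      refine bot_ne_top (α := Subrepresentation ρ) ?_
      exact Subrepresentation.toSubmodule_injective (Subsingleton.elim _ _)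
    · rcases eq_bot_or_eq_top (⟨W, hW⟩ : Subrepresentation ρ) with h | h
      · exact Or.inl (congrArg Subrepresentation.toSubmodule h)
      · exact Or.inr (congrArg Subrepresentation.toSubmodule h)
  · rintro ⟨hV, h⟩
    have : Nontrivial (Subrepresentation ρ) :=
      ⟨⊥, ⊤, fun h => bot_ne_top (α := Submodule ℂ V) (congrArg Subrepresentation.toSubmodule h)⟩
    refine ⟨fun W => ?_⟩
    rcases h W.toSubmodule W.apply_mem_toSubmodule with h | h
    · exact Or.inl (Subrepresentation.toSubmodule_injective h)
    · exact Or.inr (Subrepresentation.toSubmodule_injective h)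

theorem exists_irreducible_toRepresentation_le [FiniteDimensional ℂ V] (ρ : Representation ℂ G V)
    (W : Subrepresentation ρ) (hW : W.toSubmodule ≠ ⊥) :
    ∃ U : Subrepresentation ρ, U.toSubmodule ≤ W.toSubmodule ∧ U.toRepresentation.IsIrreducible := by
  obtain ⟨U, ⟨hU0, hUW, hU⟩, hmin⟩ := WellFounded.has_min (wellFounded_lt (α := Submodule ℂ V))
    {U | U ≠ ⊥ ∧ U ≤ W.toSubmodule ∧ ∀ g, ∀ v ∈ U, ρ g v ∈ U}
    ⟨_, hW, le_rfl, W.apply_mem_toSubmodule⟩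
  refine ⟨⟨U, hU⟩, hUW, (isIrreducible_iff_forall_submodule _).2
    ⟨Submodule.nontrivial_iff_ne_bot.2 hU0, fun X hX => ?_⟩⟩
  by_contra! hne
  refine hmin (X.map U.subtype) ⟨?_, (Submodule.map_subtype_le U X).trans hUW, ?_⟩ ?_
  · exact fun h => hne.1 (Submodule.map_injective_of_injective U.injective_subtype (by simpa using h))
  · rintro g _ ⟨v, hv, rfl⟩
    exact ⟨_, hX g v hv, rfl⟩
  · refine lt_of_le_of_ne (Submodule.map_subtype_le U X) fun h => hne.2 ?_
    apply Submodule.map_injective_of_injective U.injective_subtype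
    simpa using h

theorem exists_eq_smul_one_of_forall_commute [FiniteDimensional ℂ V] (ρ : Representation ℂ G V)
    (hρ : ρ.IsIrreducible) (f : Module.End ℂ V) (hf : ∀ g, Commute f (ρ g)) :
    ∃ c : ℂ, f = c • (1 : Module.End ℂ V) := by
  rw [isIrreducible_iff_forall_submodule] at hρ
  have := hρ.1
  obtain ⟨c, hc⟩ := Module.End.exists_eigenvalue f
  refine ⟨c, ?_⟩
  have hinv : ∀ g, ∀ v ∈ f.eigenspace c, ρ g v ∈ f.eigenspace c := by
    intro g v hv
    rw [Module.End.mem_eigenspace_iff] at hv ⊢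
    rw [← Module.End.mul_apply, hf g, Module.End.mul_apply, hv, map_smul]
  have h := (hρ.2 _ hinv).resolve_left hc
  ext v
  have : v ∈ f.eigenspace c := h ▸ Submodule.mem_top
  simpa using Module.End.mem_eigenspace_iff.1 this

/-- Restricted to A, the representation contains an invariant line ℂv. Up to scalars, the G-orbit of
v has one vector per coset of A, and its span is invariant, hence all of V. -/
theorem finrank_le_index_of_isMulCommutative [Finite G] [FiniteDimensional ℂ V]
    (ρ : Representation ℂ G V) (hρ : ρ.IsIrreducible) (A : Subgroup G) (hA : IsMulCommutative A) :
    Module.finrank ℂ V ≤ A.index := by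
  rw [isIrreducible_iff_forall_submodule] at hρ
  have := hρ.1
  let σ : Representation ℂ A V := ρ.comp A.subtype
  obtain ⟨U, -, hU⟩ := exists_irreducible_toRepresentation_le σ ⊤ (top_ne_bot (α := Submodule ℂ V))
  have h1 := IsIrreducible.finrank_eq_one_of_isMulCommutative U.toRepresentation
  obtain ⟨v, hv0, hv⟩ := finrank_eq_one_iff'.1 h1
  have hv' : ∀ a ∈ A, ∃ c : ℂ, ρ a v = c • (v : V) := by
    intro a ha
    obtain ⟨c, hc⟩ := hv (U.toRepresentation ⟨a, ha⟩ v)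
    exact ⟨c, (congrArg Subtype.val hc).symm⟩
  let b : G ⧸ A → V := fun q => ρ q.out v
  have hb : ∀ g, ρ g v ∈ Submodule.span ℂ (Set.range b) := by
    intro g
    obtain ⟨c, hc⟩ := hv' (((g : G ⧸ A).out)⁻¹ * g)
      (QuotientGroup.eq.1 (Quotient.out_eq' (g : G ⧸ A)))
    have : ρ g v = c • b g := by
      rw [← map_smul, ← hc, ← Module.End.mul_apply, ← map_mul, mul_inv_cancel_left]
    rw [this]
    exact Submodule.smul_mem _ _ (Submodule.subset_span ⟨_, rfl⟩)
  have htop : Submodule.span ℂ (Set.range b) = ⊤ := by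
    refine (hρ.2 _ ?_).resolve_left ?_
    · intro g w hw
      induction hw using Submodule.span_induction with
      | mem x hx =>
        obtain ⟨q, rfl⟩ := hx
        change ρ g (ρ q.out v) ∈ _
        rw [← Module.End.mul_apply, ← map_mul]
        exact hb _
      | zero => simp
      | add x y _ _ hx hy => rw [map_add]; exact add_mem hx hy
      | smul c x _ hx => rw [map_smul]; exact Submodule.smul_mem _ _ hx
    · intro h
      have := hb 1
      rw [h, Submodule.mem_bot, map_one] at this
      exact hv0 (Subtype.ext this)
  have : Fintype (G ⧸ A) := Fintype.ofFinite _
  rw [← finrank_top ℂ V, ← htop, Subgroup.index_eq_card, Nat.card_eq_fintype_card]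
  exact finrank_range_le_card b

end Representation


/-! ### Character degrees in terms of representations. -/

theorem mem_irreducibleCharacterDegrees_of_isIrreducible {G V : Type*} [Group G] [AddCommGroup V]
    [Module ℂ V] [FiniteDimensional ℂ V] (ρ : Representation ℂ G V) (hρ : ρ.IsIrreducible) :
    Module.finrank ℂ V ∈ irreducibleCharacterDegrees G := by
  let e : V ≃ₗ[ℂ] (Fin (Module.finrank ℂ V) → ℂ) := (Module.finBasis ℂ V).equivFun
  let σ : Representation ℂ G (Fin (Module.finrank ℂ V) → ℂ) :=
    { toFun := fun g => e.conj (ρ g)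
      map_one' := by rw [map_one]; exact LinearEquiv.conj_id e
      map_mul' := fun g h => by rw [map_mul]; exact LinearEquiv.conj_comp e _ _ }
  refine ⟨σ.character, ⟨_, _, _, inferInstance, σ, ?_, rfl⟩, by rw [char_one]; simp⟩
  rw [isIrreducible_iff_forall_submodule] at hρ ⊢
  refine ⟨have := hρ.1; e.symm.toEquiv.nontrivial, fun W hW => ?_⟩
  have he : Function.Injective (Submodule.comap e.toLinearMap) :=
    Submodule.comap_injective_of_surjective (f := e.toLinearMap) e.surjective
  refine (hρ.2 (W.comap e.toLinearMap) ?_).imp (fun h => he ?_) fun h => he ?_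
  · intro g v hv
    have := hW g _ hv
    simpa [σ, LinearEquiv.conj_apply] using this
  · rw [h]; simp
  · rw [h]; simp

theorem mem_irreducibleCharacterDegrees_iff {G : Type*} [Group G] {n : ℕ} :
    n ∈ irreducibleCharacterDegrees G ↔
      ∃ (V : Type) (_ : AddCommGroup V) (_ : Module ℂ V) (_ : FiniteDimensional ℂ V)
        (ρ : Representation ℂ G V), ρ.IsIrreducible ∧ Module.finrank ℂ V = n := by
  constructor
  · rintro ⟨_, ⟨V, _, _, _, ρ, hρ, rfl⟩, h⟩
    rw [char_one] at h
    exact ⟨V, _, _, ‹_›, ρ, hρ, by exact_mod_cast h⟩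
  · rintro ⟨V, _, _, _, ρ, hρ, rfl⟩
    exact mem_irreducibleCharacterDegrees_of_isIrreducible ρ hρ

theorem irreducibleCharacterDegrees_subset_of_surjective {G Q : Type*} [Group G] [Group Q]
    (f : G →* Q) (hf : Function.Surjective f) :
    irreducibleCharacterDegrees Q ⊆ irreducibleCharacterDegrees G := by
  intro n hn
  obtain ⟨V, _, _, _, ρ, hρ, rfl⟩ := mem_irreducibleCharacterDegrees_iff.1 hn
  refine mem_irreducibleCharacterDegrees_of_isIrreducible (ρ.comp f : Representation ℂ G V) ?_
  rw [isIrreducible_iff_forall_submodule] at hρ ⊢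
  refine ⟨hρ.1, fun W hW => hρ.2 W fun q => ?_⟩
  obtain ⟨g, rfl⟩ := hf q
  exact hW g

theorem le_index_of_mem_irreducibleCharacterDegrees {G : Type*} [Group G] [Finite G] {n : ℕ}
    (hn : n ∈ irreducibleCharacterDegrees G) (A : Subgroup G) (hA : IsMulCommutative A) :
    n ≤ A.index := by
  obtain ⟨V, _, _, _, ρ, hρ, rfl⟩ := mem_irreducibleCharacterDegrees_iff.1 hn
  exact finrank_le_index_of_isMulCommutative ρ hρ A hA

-- Prescribed central characters, and representations of degree at most p.

universe u v

namespace Representation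

variable {G : Type u} {V : Type v} [Group G] [AddCommGroup V] [Module ℂ V]

/-- Inside the right regular representation, the functions with f(hz) = χ(z)f(h) form the
representation induced from χ. It is nonzero, since it contains χ extended by zero, so any
irreducible subrepresentation of it will do. -/
theorem exists_isIrreducible_forall_center_apply_eq [Finite G] (χ : Subgroup.center G →* ℂˣ) :
    ∃ (V : Type u) (_ : AddCommGroup V) (_ : Module ℂ V) (_ : FiniteDimensional ℂ V)
      (ρ : Representation ℂ G V), ρ.IsIrreducible ∧
        ∀ z : Subgroup.center G, ρ z = (χ z : ℂ) • (1 : Module.End ℂ V) := by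
  classical
  let σ : Representation ℂ G (G → ℂ) :=
    { toFun := fun g => LinearMap.funLeft ℂ ℂ fun h => h * g
      map_one' := by ext f h; simp [LinearMap.funLeft_apply]
      map_mul' := fun a b => by
        refine LinearMap.ext fun f => funext fun h => ?_
        simp [LinearMap.funLeft_apply, mul_assoc] }
  have hσ : ∀ g f h, σ g f h = f (h * g) := fun _ _ _ => rfl
  let W : Subrepresentation σ :=
    { toSubmodule :=
        { carrier := {f | ∀ (z : Subgroup.center G) h, f (h * z) = χ z * f h}
          zero_mem' := by simp
          add_mem' := fun ha hb z h => by simp [ha z h, hb z h, mul_add]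
          smul_mem' := fun c f hf z h => by simp [hf z h, mul_left_comm] }
      apply_mem_toSubmodule := fun g f hf z h => by
        rw [hσ, hσ, mul_assoc, ← Subgroup.mem_center_iff.1 z.2 g, ← mul_assoc]
        exact hf z _ }
  have hW : W.toSubmodule ≠ ⊥ := by
    rw [Submodule.ne_bot_iff]
    refine ⟨fun g => if h : g ∈ Subgroup.center G then χ ⟨g, h⟩ else 0, fun z h => ?_, ?_⟩
    · have : h * z ∈ Subgroup.center G ↔ h ∈ Subgroup.center G :=
        Subgroup.mul_mem_cancel_right _ z.2
      by_cases hh : h ∈ Subgroup.center G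
      · simp only [this.2 hh, hh, dite_true]
        rw [← Units.val_mul, ← map_mul]
        exact congrArg (fun y => (χ y : ℂ)) (Subtype.ext (Subgroup.mem_center_iff.1 z.2 h))
      · simp [this, hh]
    · intro h0
      have h1 := congrFun h0 1
      simp only [one_mem, dite_true] at h1
      exact Units.ne_zero _ h1
  obtain ⟨U, hUW, hU⟩ := exists_irreducible_toRepresentation_le σ W hW
  refine ⟨U.toSubmodule, inferInstance, inferInstance, inferInstance, U.toRepresentation, hU,
    fun z => LinearMap.ext fun f => Subtype.ext (funext fun h => ?_)⟩
  exact hUW f.2 z h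

/-- An endomorphism commuting with one that is diagonal with distinct eigenvalues in some basis is
diagonal in that basis. -/
theorem exists_apply_eq_smul_of_commute {ι : Type*} (b : Module.Basis ι ℂ V) (μ : ι → ℂ)
    (hμ : Function.Injective μ) {f g : Module.End ℂ V} (hf : ∀ i, f (b i) = μ i • b i)
    (hfg : Commute f g) (i : ι) : ∃ c : ℂ, g (b i) = c • b i := by
  refine ⟨b.repr (g (b i)) i, b.ext_elem fun j => ?_⟩
  rcases eq_or_ne i j with rfl | hij
  · simp
  have h1 : f (g (b i)) = μ i • g (b i) := by
    rw [← Module.End.mul_apply, hfg, Module.End.mul_apply, hf, map_smul]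
  have h2 : ∀ v, b.repr (f v) j = μ j * b.repr v j := by
    intro v
    have : (b.coord j) ∘ₗ f = μ j • b.coord j := by
      refine b.ext fun k => ?_
      rcases eq_or_ne k j with rfl | hk
      · simp [hf]
      · simp [hf, Finsupp.single_eq_of_ne' hk]
    exact LinearMap.congr_fun this v
  have h3 := h2 (g (b i))
  rw [h1] at h3
  have h4 : (μ i - μ j) * b.repr (g (b i)) j = 0 := by
    rw [sub_mul, ← h3]; simp
  have h5 := (mul_eq_zero.1 h4).resolve_left (sub_ne_zero.2 (hμ.ne hij))
  rw [h5]
  simp [Finsupp.single_eq_of_ne' hij]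

/-- With C the subgroup of elements acting centrally on the image of ρ, G/C is a nontrivial p-group,
and x lifts a nontrivial element of its center. -/
theorem exists_center_mod_scalars {p : ℕ} (hp : p.Prime) [Finite G] (hG : IsPGroup p G)
    (ρ : Representation ℂ G V) (hρ : ∃ g h, ¬ Commute (ρ g) (ρ h)) :
    ∃ x : G, (∃ g : G, ρ ⁅g, x⁆ ≠ 1) ∧ ∀ g h : G, Commute (ρ ⁅g, x⁆) (ρ h) := by
  have : Fact p.Prime := ⟨hp⟩
  let C : Subgroup G :=
    { carrier := {g | ∀ h, Commute (ρ g) (ρ h)}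
      one_mem' := fun h => by rw [map_one]; exact Commute.one_left _
      mul_mem' := fun ha hb h => by rw [map_mul]; exact (ha h).mul_left (hb h)
      inv_mem' := by
        intro a ha h
        have h1 := congrArg (fun f => ρ a⁻¹ * f * ρ a⁻¹) (ha h).eq
        simp only [← map_mul] at h1 ⊢
        rw [Commute, SemiconjBy, ← map_mul, ← map_mul]
        simpa [mul_assoc] using h1.symm }
  have hC : C.Normal := by
    refine ⟨fun a ha g h => ?_⟩
    have : ρ (g * a * g⁻¹) = ρ a := by
      rw [map_mul, map_mul, ← (ha g).eq, mul_assoc, ← map_mul, mul_inv_cancel, map_one, mul_one]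
    rw [this]
    exact ha h
  have hne : Nontrivial (G ⧸ C) := by
    obtain ⟨g, h, hgh⟩ := hρ
    rw [QuotientGroup.nontrivial_iff]
    intro hC
    have : g ∈ C := hC ▸ Subgroup.mem_top g
    exact hgh (this h)
  have := (hG.to_quotient C).center_nontrivial
  obtain ⟨⟨q, hq⟩, hq1⟩ := exists_ne (1 : Subgroup.center (G ⧸ C))
  obtain ⟨x, rfl⟩ := QuotientGroup.mk_surjective q
  have hx : x ∉ C := fun h => hq1 (Subtype.ext ((QuotientGroup.eq_one_iff x).2 h))
  refine ⟨x, ?_, fun g => ?_⟩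
  · by_contra! h
    refine hx fun g => ?_
    have h1 := h g
    have : g * x = ⁅g, x⁆ * (x * g) := by simp [commutatorElement_def, mul_assoc]
    rw [Commute, SemiconjBy, ← map_mul ρ g, this, map_mul, h1, one_mul, map_mul]
  · have : ⁅g, x⁆ ∈ C := by
      rw [← QuotientGroup.eq_one_iff]
      have := Subgroup.mem_center_iff.1 hq (g : G ⧸ C)
      rw [← QuotientGroup.mk'_apply, map_commutatorElement, commutatorElement_eq_one_iff_mul_comm]
      exact this
    exact this

/-- In the noncommutative case take x, not acting as a scalar, whose commutators ⁅g, x⁆ all act as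
scalars ζ(g). Then ζ is a nontrivial linear character, and G moves an eigenvector of x to
eigenvectors with |im ζ| distinct eigenvalues. As |im ζ| is a power of p, the bound on the dimension
makes x diagonal with p distinct eigenvalues. The kernel of ζ commutes with x, so it acts diagonally
in the same basis. -/
theorem exists_index_eq_forall_commutator_apply_eq_one {p : ℕ} (hp : p.Prime) [Finite G]
    [Nontrivial G] (hG : IsPGroup p G) [FiniteDimensional ℂ V] (ρ : Representation ℂ G V)
    (hρ : ρ.IsIrreducible) (hdim : Module.finrank ℂ V ≤ p) :
    ∃ M : Subgroup G, M.index = p ∧ ∀ a ∈ M, ∀ b ∈ M, Commute (ρ a) (ρ b) := by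
  have : Fact p.Prime := ⟨hp⟩
  by_cases hcomm : ∀ g h, Commute (ρ g) (ρ h)
  · obtain ⟨n, hn0, hn⟩ := hG.nontrivial_iff_card.1 ‹_›
    obtain ⟨M, hM⟩ := Sylow.exists_subgroup_card_pow_prime (G := G) p (n := n - 1)
      (hn ▸ pow_dvd_pow p (n.sub_le 1))
    refine ⟨M, ?_, fun a _ b _ => hcomm a b⟩
    have h := M.card_mul_index
    rw [hM, hn, ← Nat.sub_add_cancel hn0, Nat.sub_add_cancel hn0] at h
    apply Nat.eq_of_mul_eq_mul_left (pow_pos hp.pos (n - 1))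
    rw [h, ← pow_succ, Nat.sub_add_cancel hn0]
  push Not at hcomm
  obtain ⟨x, ⟨g₀, hg₀⟩, hx⟩ := exists_center_mod_scalars hp hG ρ hcomm
  have hsc : ∀ g, ∃ c : ℂ, ρ ⁅g, x⁆ = c • (1 : Module.End ℂ V) := fun g =>
    exists_eq_smul_one_of_forall_commute ρ hρ _ (hx g)
  choose c hc using hsc
  have := ((isIrreducible_iff_forall_submodule ρ).1 hρ).1
  obtain ⟨v₀, hv₀⟩ := exists_ne (0 : V)
  have hinj : ∀ {a b : ℂ}, a • (1 : Module.End ℂ V) = b • (1 : Module.End ℂ V) → a = b := by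
    intro a b h
    have := LinearMap.congr_fun h v₀
    exact smul_left_injective ℂ hv₀ (by simpa using this)
  let ζ : G →* ℂ :=
    { toFun := c
      map_one' := hinj (by rw [← hc]; simp)
      map_mul' := fun a b => hinj (by
        rw [← hc, commutatorElement_mul_left_eq_conj_mul, map_mul, map_mul, map_mul,
          ← (hx b a).eq, mul_assoc (ρ ⁅b, x⁆), ← map_mul, mul_inv_cancel, map_one, mul_one, hc, hc]
        rw [smul_mul_smul_comm, one_mul, mul_comm]) }
  obtain ⟨μ, hμ⟩ := Module.End.exists_eigenvalue (ρ x)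
  obtain ⟨v, hv⟩ := hμ.exists_hasEigenvector
  have hconj : ∀ g, ρ x (ρ g⁻¹ v) = (ζ g * μ) • ρ g⁻¹ v := by
    intro g
    have h1 : x * g⁻¹ = g⁻¹ * ⁅g, x⁆ * x := by simp [commutatorElement_def, mul_assoc]
    rw [← Module.End.mul_apply, ← map_mul, h1, map_mul, map_mul, hc]
    simp [hv.apply_eq_smul, ζ, smul_smul]
  let φ : G →* ℂˣ := ζ.toHomUnits
  have hμ0 : μ ≠ 0 := by
    rintro rfl
    have h1 : ρ x⁻¹ (ρ x v) = v := by rw [← Module.End.mul_apply, ← map_mul]; simp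
    rw [hv.apply_eq_smul] at h1
    simp at h1
    exact hv.2 h1.symm
  have hr : ∀ i : φ.range, ∃ g, φ g = i := fun i => i.2
  choose r hr using hr
  have hφ : ∀ g, ((φ g : ℂˣ) : ℂ) = ζ g := fun g => rfl
  have hμi : Function.Injective fun i : φ.range => ((i : ℂˣ) : ℂ) * μ := by
    intro i j hij
    exact Subtype.ext (Units.ext (mul_right_cancel₀ hμ0 hij))
  have hev : ∀ i : φ.range, Module.End.HasEigenvector (ρ x) (((i : ℂˣ) : ℂ) * μ) (ρ (r i)⁻¹ v) := by
    intro i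
    refine ⟨Module.End.mem_eigenspace_iff.2 ?_, ?_⟩
    · rw [hconj, ← hφ, hr]
    · intro h0
      have h1 : ρ (r i) (ρ (r i)⁻¹ v) = v := by rw [← Module.End.mul_apply, ← map_mul]; simp
      rw [h0, map_zero] at h1
      exact hv.2 h1.symm
  have hli : LinearIndependent ℂ fun i : φ.range => ρ (r i)⁻¹ v :=
    Module.End.eigenvectors_linearIndependent' (ρ x) _ hμi _ hev
  have : Finite φ.range := Finite.of_surjective _ φ.rangeRestrict_surjective
  have : Fintype φ.range := Fintype.ofFinite _
  have hle := hli.fintype_card_le_finrank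
  have hcard : Nat.card φ.range = φ.ker.index := (Subgroup.index_ker φ).symm
  obtain ⟨k, hk⟩ := hG.index φ.ker
  have hk0 : k ≠ 0 := by
    rintro rfl
    rw [pow_zero, Subgroup.index_eq_one] at hk
    have : g₀ ∈ φ.ker := hk ▸ Subgroup.mem_top _
    apply hg₀
    have h1 : ζ g₀ = 1 := congrArg Units.val (MonoidHom.mem_ker.1 this)
    have h2 : c g₀ = 1 := h1
    rw [hc, h2, one_smul]
  have hpk : p ≤ p ^ k := Nat.le_self_pow hk0 p
  rw [← Nat.card_eq_fintype_card, hcard, hk] at hle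
  -- The chain p ≤ p ^ k ≤ dim V ≤ p collapses, so the eigenvectors form a basis.
  have hp1 : p ^ k = p := le_antisymm (hle.trans hdim) hpk
  have hfr : Fintype.card φ.range = Module.finrank ℂ V := by
    rw [← Nat.card_eq_fintype_card, hcard, hk]; omega
  refine ⟨φ.ker, hk.trans hp1, fun a ha b hb => ?_⟩
  have : Nonempty φ.range := ⟨1⟩
  let e := basisOfLinearIndependentOfCardEqFinrank hli hfr
  have he : ∀ i, ρ x (e i) = (((i : ℂˣ) : ℂ) * μ) • e i := by
    intro i
    simp only [e, coe_basisOfLinearIndependentOfCardEqFinrank]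
    exact (hev i).apply_eq_smul
  have hker : ∀ a ∈ φ.ker, Commute (ρ x) (ρ a) := by
    intro a ha
    have h1 : c a = 1 := congrArg Units.val (MonoidHom.mem_ker.1 ha)
    have h2 : a * x = ⁅a, x⁆ * (x * a) := by simp [commutatorElement_def, mul_assoc]
    have h3 := congrArg ρ h2
    rw [map_mul, map_mul, hc, h1, one_smul, one_mul, map_mul] at h3
    exact h3.symm
  refine e.ext fun i => ?_
  obtain ⟨s, hs⟩ := exists_apply_eq_smul_of_commute e _ hμi he (hker a ha) i
  obtain ⟨t, ht⟩ := exists_apply_eq_smul_of_commute e _ hμi he (hker b hb) i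
  simp only [Module.End.mul_apply, hs, ht, map_smul, smul_smul, mul_comm]

end Representation

/-! ### Maximal and abelian normal subgroups of p-groups. -/

section GroupTheory

variable {G : Type*} [Group G]

theorem Subgroup.normal_of_le_center {N : Subgroup G} (h : N ≤ Subgroup.center G) : N.Normal :=
  ⟨fun a ha g => by rwa [Subgroup.mem_center_iff.1 (h ha) g, mul_inv_cancel_right]⟩

theorem commutator_le_of_closure_eq_top {N : Subgroup G} [N.Normal] {S : Set G}
    (hS : Subgroup.closure S = ⊤) (h : ∀ a ∈ S, ∀ b ∈ S, ⁅a, b⁆ ∈ N) : commutator G ≤ N := by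
  rw [← Subgroup.Normal.quotient_commutative_iff_commutator_le]
  have h1 : IsMulCommutative (Subgroup.closure (QuotientGroup.mk' N '' S)) := by
    refine Subgroup.isMulCommutative_closure ?_
    rintro _ ⟨a, ha, rfl⟩ _ ⟨b, hb, rfl⟩
    rw [← commutatorElement_eq_one_iff_mul_comm, ← map_commutatorElement, QuotientGroup.mk'_apply,
      QuotientGroup.eq_one_iff]
    exact h a ha b hb
  rw [← MonoidHom.map_closure, hS, Subgroup.map_top_of_surjective _ (QuotientGroup.mk'_surjective N)]
    at h1
  exact ⟨⟨fun a b => congrArg Subtype.val (h1.is_comm.comm ⟨a, Subgroup.mem_top a⟩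
    ⟨b, Subgroup.mem_top b⟩)⟩⟩

theorem Subgroup.eq_top_of_index_prime_of_lt {p : ℕ} (hp : p.Prime) {M K : Subgroup G}
    (hM : M.index = p) (h : M < K) : K = ⊤ := by
  have h1 := Subgroup.relIndex_mul_index h.le
  rw [hM] at h1
  rcases (Nat.dvd_prime hp).1 ⟨_, (mul_comm _ _).trans h1 |>.symm⟩ with h2 | h2
  · exact Subgroup.index_eq_one.1 h2
  · rw [h2] at h1
    have : M.relIndex K = 1 := Nat.eq_of_mul_eq_mul_right hp.pos (by rw [h1, one_mul])
    exact absurd (Subgroup.relIndex_eq_one.1 this) h.not_ge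

theorem Subgroup.sup_zpowers_eq_top_of_index_prime {p : ℕ} (hp : p.Prime) {M : Subgroup G}
    (hM : M.index = p) {x : G} (hx : x ∉ M) : M ⊔ Subgroup.zpowers x = ⊤ :=
  Subgroup.eq_top_of_index_prime_of_lt hp hM (lt_of_le_of_ne le_sup_left fun h => hx <| by
    rw [h]; exact Subgroup.mem_sup_right (Subgroup.mem_zpowers x))

theorem commutator_le_of_index_prime {p : ℕ} (hp : p.Prime) {M : Subgroup G} [M.Normal]
    (hM : M.index = p) : commutator G ≤ M := by
  have : Fact p.Prime := ⟨hp⟩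
  have : IsCyclic (G ⧸ M) := isCyclic_of_prime_card (p := p) hM
  exact Subgroup.Normal.quotient_commutative_iff_commutator_le.1 inferInstance

theorem IsPGroup.normal_of_index_eq {p : ℕ} (hp : p.Prime) [Finite G] (hG : IsPGroup p G)
    {M : Subgroup G} (hM : M.index = p) : M.Normal := by
  have : Fact p.Prime := ⟨hp⟩
  obtain ⟨n, hn⟩ := IsPGroup.iff_card.1 hG
  apply Subgroup.normal_of_index_eq_minFac_card
  rw [hM, hn, hp.pow_minFac]
  rintro rfl
  have h1 := M.index_dvd_card
  rw [hn, hM, pow_zero, Nat.dvd_one] at h1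
  exact hp.one_lt.ne' h1

theorem IsPGroup.exists_mem_center_of_normal {p : ℕ} (hp : p.Prime) [Finite G] (hG : IsPGroup p G)
    (N : Subgroup G) [N.Normal] (hN : N ≠ ⊥) :
    ∃ z ∈ N, z ∈ Subgroup.center G ∧ orderOf z = p := by
  have : Fact p.Prime := ⟨hp⟩
  have hcard : p ∣ Nat.card N := by
    refine ((hG.to_subgroup N).card_eq_or_dvd).resolve_left fun h => hN ?_
    exact Subgroup.card_eq_one.1 h
  obtain ⟨⟨z, hz⟩, hz1, hz2⟩ := (hG.of_equiv ConjAct.toConjAct)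
    |>.exists_fixed_point_of_prime_dvd_card_of_fixed_point N hcard (a := 1) (fun g => smul_one g)
  have hzc : z ∈ Subgroup.center G := by
    rw [Subgroup.mem_center_iff]
    intro g
    have := congrArg Subtype.val (hz1 (ConjAct.toConjAct g))
    rw [ConjAct.Subgroup.val_conj_smul, ConjAct.toConjAct_smul] at this
    exact mul_inv_eq_iff_eq_mul.1 this
  have hz0 : z ≠ 1 := fun h => hz2 (Subtype.ext h.symm)
  refine ⟨z ^ (orderOf z / p), pow_mem hz _, pow_mem hzc _, ?_⟩
  exact orderOf_pow_orderOf_div (orderOf_pos z).ne' (hG.dvd_orderOf hz0)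

/-- The endomorphism `a ↦ ⁅s, a⁆` of an abelian normal subgroup. -/
def Subgroup.commutatorHom (A : Subgroup G) [A.Normal] (hA : IsMulCommutative A) (s : G) :
    A →* A where
  toFun a := ⟨⁅s, (a : G)⁆, Subgroup.commutator_le_right ⊤ A
    (Subgroup.commutator_mem_commutator (Subgroup.mem_top s) a.2)⟩
  map_one' := Subtype.ext (commutatorElement_one_right s)
  map_mul' a b := by
    have h1 : (a : G) * ⁅s, (b : G)⁆ = ⁅s, (b : G)⁆ * a :=
      congrArg Subtype.val (hA.is_comm.comm a ⟨⁅s, (b : G)⁆, Subgroup.commutator_le_right ⊤ A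
        (Subgroup.commutator_mem_commutator (Subgroup.mem_top s) b.2)⟩)
    refine Subtype.ext ?_
    change ⁅s, (a * b : G)⁆ = ⁅s, (a : G)⁆ * ⁅s, (b : G)⁆
    rw [commutatorElement_mul_right_eq_mul_conj, mul_assoc ⁅s, (a : G)⁆, h1]
    simp [mul_assoc]

theorem Subgroup.coe_commutatorHom (A : Subgroup G) [A.Normal] (hA : IsMulCommutative A) (s : G)
    (a : A) : (A.commutatorHom hA s a : G) = ⁅s, (a : G)⁆ := rfl

/-- The image of a ↦ ⁅s, a⁆ is normalized by A and by s, hence normal. Modulo it the generators A ∪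
{s} commute. -/
theorem commutator_le_range_commutatorHom (A : Subgroup G) [A.Normal] (hA : IsMulCommutative A)
    (s : G) (hs : A ⊔ Subgroup.zpowers s = ⊤) :
    commutator G ≤ (A.commutatorHom hA s).range.map A.subtype := by
  set N := (A.commutatorHom hA s).range.map A.subtype with hN
  have hmem : ∀ a ∈ A, ⁅s, a⁆ ∈ N := fun a ha => ⟨_, ⟨⟨a, ha⟩, rfl⟩, rfl⟩
  have hNA : N ≤ A := Subgroup.map_subtype_le _
  have hcomm : ∀ a ∈ A, ∀ b ∈ A, a * b = b * a := fun a ha b hb =>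
    congrArg Subtype.val (hA.is_comm.comm ⟨a, ha⟩ ⟨b, hb⟩)
  have hnorm : N.Normal := by
    rw [← Subgroup.normalizer_eq_top_iff, eq_top_iff, ← hs, sup_le_iff]
    constructor
    · intro a ha
      rw [Subgroup.mem_normalizer_iff]
      intro n
      constructor
      · intro hn
        rwa [hcomm a ha n (hNA hn), mul_inv_cancel_right]
      · intro hn
        have h1 := hcomm a ha _ (hNA hn)
        have h2 : a * n * a⁻¹ = n := by
          have h3 : a * (a * n * a⁻¹) = a * n := by rw [h1]; group
          exact mul_left_cancel h3
        rwa [h2] at hn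
    · rw [Subgroup.zpowers_le, Subgroup.mem_normalizer_iff]
      have hA' : A.Normal := inferInstance
      intro n
      constructor
      · rintro ⟨_, ⟨a, rfl⟩, rfl⟩
        have := hmem (s * a * s⁻¹) (hA'.conj_mem a a.2 s)
        rw [Subgroup.subtype_apply, Subgroup.coe_commutatorHom]
        convert this using 1
        simp [commutatorElement_def, mul_assoc]
      · rintro ⟨_, ⟨a, rfl⟩, h⟩
        have := hmem (s⁻¹ * a * s) (by simpa using hA'.conj_mem a a.2 s⁻¹)
        rw [Subgroup.subtype_apply, Subgroup.coe_commutatorHom] at h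
        convert this using 1
        have h2 : n = s⁻¹ * ⁅s, (a : G)⁆ * s := by rw [h]; group
        rw [h2]
        simp [commutatorElement_def, mul_assoc]
  refine commutator_le_of_closure_eq_top (S := A ∪ {s}) ?_ ?_
  · rw [Subgroup.closure_union, Subgroup.closure_eq, ← Subgroup.zpowers_eq_closure, hs]
  · rintro a (ha | ha) b (hb | hb)
    · rw [commutatorElement_eq_one_iff_mul_comm.2 (hcomm a ha b hb)]; exact one_mem _
    · rw [Set.mem_singleton_iff.1 hb, ← commutatorElement_inv]
      exact inv_mem (hmem a ha)
    · rw [Set.mem_singleton_iff.1 ha]; exact hmem b hb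
    · rw [Set.mem_singleton_iff.1 ha, Set.mem_singleton_iff.1 hb, commutatorElement_self]
      exact one_mem _

/-! ### 2-groups with small abelianization. -/

theorem eq_of_mem_zpowers_of_orderOf_eq_two [Finite G] {c z w : G} (hz : z ∈ Subgroup.zpowers c)
    (hw : w ∈ Subgroup.zpowers c) (hz2 : orderOf z = 2) (hw2 : orderOf w = 2) : z = w := by
  classical
  have : Fintype (Subgroup.zpowers c) := Fintype.ofFinite _
  have h := IsCyclic.card_pow_eq_one_le (α := Subgroup.zpowers c) (n := 2) two_pos
  by_contra hne
  have h1 : ∀ {y : G}, orderOf y = 2 → y ≠ 1 := by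
    rintro y hy rfl
    simp at hy
  have h3 : ({1, ⟨z, hz⟩, ⟨w, hw⟩} : Finset (Subgroup.zpowers c)).card = 3 := by
    rw [Finset.card_eq_three]
    refine ⟨_, _, _, ?_, ?_, ?_, rfl⟩
    · exact fun h => h1 hz2 (congrArg Subtype.val h).symm
    · exact fun h => h1 hw2 (congrArg Subtype.val h).symm
    · exact fun h => hne (congrArg Subtype.val h)
  have h4 : ({1, ⟨z, hz⟩, ⟨w, hw⟩} : Finset (Subgroup.zpowers c)) ⊆
      Finset.univ.filter fun a => a ^ 2 = 1 := by
    intro a ha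
    simp only [Finset.mem_insert, Finset.mem_singleton] at ha
    rcases ha with rfl | rfl | rfl
    · simp
    · simpa [Subtype.ext_iff] using hz2 ▸ pow_orderOf_eq_one z
    · simpa [Subtype.ext_iff] using hw2 ▸ pow_orderOf_eq_one w
  have := Finset.card_le_card h4
  omega

theorem zpowers_index_le_two_of_card_le [Finite G] {x : G}
    (h : Nat.card G ≤ 2 * orderOf x) : (Subgroup.zpowers x).index ≤ 2 := by
  have h1 := (Subgroup.zpowers x).index_mul_card
  rw [Nat.card_zpowers] at h1
  rw [← h1] at h
  exact Nat.le_of_mul_le_mul_right h (orderOf_pos x)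

/-- A finite `2`-group whose abelianization has order at most `4` has a cyclic subgroup of index at
most `2`. -/
theorem IsPGroup.exists_zpowers_index_le_two {G : Type*} [Group G] [Finite G] (hG : IsPGroup 2 G)
    (hindex : (commutator G).index ∣ 2 ^ 2) : ∃ x : G, (Subgroup.zpowers x).index ≤ 2 := by
  induction hn : Nat.card G using Nat.strong_induction_on generalizing G with
  | _ n ih =>
  subst hn
  have h4 : (commutator G).index ≤ 4 := Nat.le_of_dvd (by norm_num) hindex
  by_cases hbot : commutator G = ⊥
  · rw [hbot, Subgroup.index_bot] at h4
    rcases subsingleton_or_nontrivial G with h | h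
    · exact ⟨1, zpowers_index_le_two_of_card_le (by simp)⟩
    · obtain ⟨x, hx⟩ := exists_ne (1 : G)
      refine ⟨x, zpowers_index_le_two_of_card_le ?_⟩
      have := orderOf_pos x
      have : orderOf x ≠ 1 := by simpa using hx
      omega
  obtain ⟨z, hzG, hzc, hz2⟩ := hG.exists_mem_center_of_normal Nat.prime_two (commutator G) hbot
  have hzn : (Subgroup.zpowers z).Normal :=
    Subgroup.normal_of_le_center (Subgroup.zpowers_le.2 hzc)
  have hlt : Nat.card (G ⧸ Subgroup.zpowers z) < Nat.card G := by
    rw [← Subgroup.index_eq_card, ← (Subgroup.zpowers z).index_mul_card, Nat.card_zpowers, hz2]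
    have := Subgroup.index_ne_zero_of_finite (H := Subgroup.zpowers z)
    omega
  have hsurj := QuotientGroup.mk'_surjective (Subgroup.zpowers z)
  obtain ⟨x', hx'⟩ := ih _ hlt (hG.to_quotient _) (by
    refine dvd_trans ?_ hindex
    have := Subgroup.index_map_dvd (commutator G) hsurj
    rwa [map_commutator_eq, MonoidHom.range_eq_top.2 hsurj, ← commutator_def] at this) rfl
  obtain ⟨x, rfl⟩ := hsurj x'
  -- By induction G/⟨z⟩ has a cyclic subgroup ⟨x̄⟩ of index at most 2. Its preimage B = ⟨x, z⟩ is
  -- abelian, so it has index exactly 2, and G' ≤ ⟨⁅s, x⁆⟩ is cyclic.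
  set B := (Subgroup.zpowers (QuotientGroup.mk' (Subgroup.zpowers z) x)).comap
    (QuotientGroup.mk' (Subgroup.zpowers z)) with hB
  have hBindex : B.index ≤ 2 := by rwa [hB, Subgroup.index_comap_of_surjective _ hsurj]
  have hxB : x ∈ B := Subgroup.mem_zpowers _
  have hBmem : ∀ b ∈ B, ∃ k m : ℤ, b = x ^ k * z ^ m := by
    rintro b ⟨k, hk⟩
    have h1 : (x ^ k)⁻¹ * b ∈ Subgroup.zpowers z := by
      rw [← QuotientGroup.eq]
      exact hk
    obtain ⟨m, hm⟩ := h1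
    exact ⟨k, m, by simp only at hm; rw [hm, mul_inv_cancel_left]⟩
  have hzx : Commute z x := (Subgroup.mem_center_iff.1 hzc x).symm
  have hBcomm : IsMulCommutative B := by
    rw [← Subgroup.le_centralizer_iff_isMulCommutative]
    intro a ha b hb
    obtain ⟨k, m, rfl⟩ := hBmem a ha
    obtain ⟨k', m', rfl⟩ := hBmem b hb
    have h1 : ∀ i j : ℤ, Commute (x ^ i) (z ^ j) := fun i j => (hzx.symm.zpow_zpow i j)
    exact (((Commute.refl x).zpow_zpow k' k).mul_right (h1 k' m)).mul_left
      (((h1 k m').symm).mul_right ((Commute.refl z).zpow_zpow m' m))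
  have hB2 : B.index = 2 := by
    have h0 := Subgroup.index_ne_zero_of_finite (H := B)
    have h1 : B.index ≠ 1 := by
      intro h
      rw [Subgroup.index_eq_one] at h
      apply hbot
      rw [commutator_def, ← h, Subgroup.commutator_self_eq_bot_iff]
      exact hBcomm
    omega
  have hBn : B.Normal := Subgroup.normal_of_index_eq_two hB2
  obtain ⟨s, hs⟩ : ∃ s, s ∉ B := by
    by_contra! h
    rw [(Subgroup.eq_top_iff' B).2 h, Subgroup.index_top] at hB2
    omega
  have hle : commutator G ≤ Subgroup.zpowers ⁅s, x⁆ := by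
    refine (commutator_le_range_commutatorHom B hBcomm s
      (Subgroup.sup_zpowers_eq_top_of_index_prime Nat.prime_two hB2 hs)).trans ?_
    rintro _ ⟨_, ⟨⟨b, hb⟩, rfl⟩, rfl⟩
    obtain ⟨k, m, rfl⟩ := hBmem b hb
    have hzB : z ∈ B := by
      change (QuotientGroup.mk' (Subgroup.zpowers z) z) ∈
        Subgroup.zpowers (QuotientGroup.mk' (Subgroup.zpowers z) x)
      have h0 : QuotientGroup.mk' (Subgroup.zpowers z) z = 1 :=
        (QuotientGroup.eq_one_iff z).2 (Subgroup.mem_zpowers z)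
      rw [h0]
      exact one_mem _
    have h1 : (⟨x ^ k * z ^ m, hb⟩ : B) = ⟨x, hxB⟩ ^ k * ⟨z, hzB⟩ ^ m := Subtype.ext (by simp)
    have h2 : B.commutatorHom hBcomm s ⟨z, hzB⟩ = 1 := Subtype.ext
      (commutatorElement_eq_one_iff_mul_comm.2 (Subgroup.mem_center_iff.1 hzc s))
    rw [h1, map_mul, map_zpow, map_zpow, h2, one_zpow, mul_one, map_zpow]
    exact Subgroup.zpow_mem _ (Subgroup.mem_zpowers _) k
  by_cases hx2 : x ^ 2 = 1
  -- Here |G| ≤ 8, so any element of order at least 4 suffices. One exists, as a group of exponent 2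
  -- is abelian.
  · by_cases hsq : ∀ g : G, g ^ 2 = 1
    · exfalso
      apply hbot
      rw [commutator_def, eq_bot_iff, Subgroup.commutator_le]
      intro a _ b _
      have h1 : ∀ g : G, g⁻¹ = g := fun g => inv_eq_of_mul_eq_one_right (by rw [← sq, hsq])
      rw [Subgroup.mem_bot, commutatorElement_eq_one_iff_mul_comm]
      rw [← h1 (a * b), mul_inv_rev, h1, h1]
    · push Not at hsq
      obtain ⟨g, hg⟩ := hsq
      refine ⟨g, zpowers_index_le_two_of_card_le ?_⟩
      have hg4 : 4 ≤ orderOf g := by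
        have : Fact (Nat.Prime 2) := ⟨Nat.prime_two⟩
        obtain ⟨k, hk⟩ := IsPGroup.iff_orderOf.1 hG g
        have hk2 : 2 ≤ k := by
          by_contra! hk2
          apply hg
          rw [← orderOf_dvd_iff_pow_eq_one, hk]
          exact (pow_dvd_pow 2 (by omega : k ≤ 1)).trans (by norm_num)
        rw [hk]
        exact Nat.pow_le_pow_right two_pos hk2
      have hxo : orderOf x ≤ 2 := orderOf_le_of_pow_eq_one two_pos hx2
      have hq : (Subgroup.zpowers (QuotientGroup.mk' (Subgroup.zpowers z) x)).index *
          orderOf (QuotientGroup.mk' (Subgroup.zpowers z) x) = Nat.card (G ⧸ Subgroup.zpowers z) := by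
        rw [← Nat.card_zpowers, Subgroup.index_mul_card]
      have hqo : orderOf (QuotientGroup.mk' (Subgroup.zpowers z) x) ≤ 2 :=
        orderOf_le_of_pow_eq_one two_pos (by rw [← map_pow, hx2, map_one])
      have hG8 := (Subgroup.zpowers z).index_mul_card
      rw [Nat.card_zpowers, hz2, Subgroup.index_eq_card, ← hq] at hG8
      rw [← hG8]
      have := Nat.mul_le_mul hx' hqo
      omega
  -- Since |B : G'| ≤ 2, `x ^ 2` lies in G'. The cyclic group containing G' has only one involution,
  -- so z is a power of `x ^ 2` and B = ⟨x⟩.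
  · refine ⟨x, ?_⟩
    have hBx : B ≤ Subgroup.zpowers x := by
      have hxG : x ^ 2 ∈ commutator G := by
        have hGB := commutator_le_of_index_prime Nat.prime_two hB2
        refine (Subgroup.pow_mem_of_relIndex_ne_zero_of_dvd (H := commutator G) (K := B)
          (Subgroup.index_ne_zero_of_finite (H := (commutator G).subgroupOf B)) hxB ?_).1
        have h1 := Subgroup.relIndex_mul_index hGB
        rw [hB2] at h1
        rw [← h1, sq] at hindex
        have h2 := Nat.le_of_dvd two_pos (Nat.dvd_of_mul_dvd_mul_right two_pos hindex)
        intro m hm0 hm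
        have hm2 := hm.trans h2
        interval_cases m <;> norm_num
      have h2 : 2 ∣ orderOf (x ^ 2) := by
        have : Fact (Nat.Prime 2) := ⟨Nat.prime_two⟩
        exact hG.dvd_orderOf hx2
      have h3 := orderOf_pow_orderOf_div (orderOf_pos (x ^ 2)).ne' h2
      have h4 := eq_of_mem_zpowers_of_orderOf_eq_two (hle hzG)
        (hle (pow_mem hxG (orderOf (x ^ 2) / 2))) hz2 h3
      have hzx' : z ∈ Subgroup.zpowers x := by
        rw [h4]
        exact pow_mem (pow_mem (Subgroup.mem_zpowers x) _) _
      intro b hb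
      obtain ⟨k, m, rfl⟩ := hBmem b hb
      exact mul_mem (zpow_mem (Subgroup.mem_zpowers x) k) (zpow_mem hzx' m)
    exact (Subgroup.index_antitone hBx).trans hBindex

end GroupTheory

/-! ### Abelian subgroups of small index. -/

theorem AddMonoid.End.card_ker_pow_le {M : Type*} [AddCommGroup M] [Finite M]
    (T : AddMonoid.End M) (k : ℕ) :
    Nat.card (AddMonoidHom.ker (T ^ k : AddMonoid.End M)) ≤ Nat.card (AddMonoidHom.ker T) ^ k := by
  induction k with
  | zero =>
    have : AddMonoidHom.ker (T ^ 0 : AddMonoid.End M) = ⊥ := by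
      rw [pow_zero, eq_bot_iff]
      exact fun x hx => hx
    rw [this, pow_zero, AddSubgroup.card_bot]
  | succ k ih =>
    set K := AddMonoidHom.ker (T ^ k : AddMonoid.End M) with hK
    set L := AddMonoidHom.ker (T ^ (k + 1) : AddMonoid.End M) with hL
    have hKL : K ≤ L := fun x hx => by
      change (T ^ (k + 1)) x = 0
      rw [pow_succ']
      change T ((T ^ k) x) = 0
      rw [(show (T ^ k) x = 0 from hx), map_zero]
    have h1 := AddSubgroup.relIndex_ker (T ^ k : AddMonoid.End M) (K := L)
    -- T ^ k maps ker T ^ (k + 1) into ker T, with kernel ker T ^ k.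
    have h2 : Nat.card (L.map (T ^ k : AddMonoid.End M)) ≤ Nat.card (AddMonoidHom.ker T) := by
      refine Nat.card_mono (Set.toFinite _) ?_
      rintro _ ⟨x, hx, rfl⟩
      have h : (T ^ (k + 1)) x = 0 := hx
      rw [pow_succ'] at h
      exact h
    have h3 := AddSubgroup.relIndex_mul_relIndex ⊥ K L bot_le hKL
    rw [AddSubgroup.relIndex_bot_left, AddSubgroup.relIndex_bot_left, h1] at h3
    rw [← h3, pow_succ]
    exact Nat.mul_le_mul ih h2

section

variable {G : Type*} [Group G] [Finite G]

-- Let T be a ↦ ⁅s, a⁆ on A, written additively, with s outside A. Since G' ≤ im T, |ker T| = |A :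
-- im T| ≤ p. Conjugation by s is 1 + T, and its p-th power is trivial because s ^ p ∈ A. As p kills
-- A, (1 + T) ^ p = 1 + T ^ p, so T ^ p = 0 and |A| ≤ |ker T| ^ p.
open scoped IsMulCommutative in
theorem card_le_pow_of_index_commutator_dvd {p : ℕ} (hp : p.Prime) (A : Subgroup G) [A.Normal]
    (hA : IsMulCommutative A) (hAp : A.index = p) (hexp : ∀ a ∈ A, a ^ p = 1)
    (hindex : (commutator G).index ∣ p ^ 2) : Nat.card A ≤ p ^ p := by
  obtain ⟨s, hs⟩ : ∃ s, s ∉ A := by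
    by_contra! h
    rw [(Subgroup.eq_top_iff' A).2 h, Subgroup.index_top] at hAp
    exact hp.one_lt.ne hAp
  have hle := commutator_le_range_commutatorHom A hA s
    (Subgroup.sup_zpowers_eq_top_of_index_prime hp hAp hs)
  set φ := A.commutatorHom hA s with hφ
  have hker : Nat.card φ.ker ≤ p := by
    have h1 := (Subgroup.index_dvd_of_le hle).trans hindex
    rw [Subgroup.index_map_subtype, hAp, sq] at h1
    have h2 := Nat.le_of_dvd hp.pos (Nat.dvd_of_mul_dvd_mul_right hp.pos h1)
    have h3 := φ.ker.card_mul_index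
    rw [Subgroup.index_ker, ← φ.range.index_mul_card] at h3
    exact (Nat.eq_of_mul_eq_mul_right Nat.card_pos h3).le.trans h2
  let T : AddMonoid.End (Additive A) := MonoidHom.toAdditive φ
  have hT : ∀ a : A, T (Additive.ofMul a) = Additive.ofMul (φ a) := fun _ => rfl
  have hpow : ∀ (k : ℕ) (a : A),
      (((1 + T) ^ k) (Additive.ofMul a)).toMul = MulAut.conjNormal (s ^ k) a := by
    intro k
    induction k with
    | zero => intro a; simp
    | succ k ih =>
      intro a
      have h1 : (1 + T) (Additive.ofMul a) = Additive.ofMul (MulAut.conjNormal s a) := by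
        change Additive.ofMul (a * φ a) = _
        refine congrArg _ (Subtype.ext ?_)
        rw [mul_comm, Subgroup.coe_mul, hφ, Subgroup.coe_commutatorHom, MulAut.conjNormal_apply,
          commutatorElement_def, inv_mul_cancel_right]
      rw [pow_succ]
      change (((1 + T) ^ k) ((1 + T) (Additive.ofMul a))).toMul = _
      rw [h1, ih, pow_succ, map_mul, MulAut.mul_apply]
  have hone : (1 + T) ^ p = 1 := by
    suffices h : ∀ a : A, (((1 + T) ^ p) (Additive.ofMul a)).toMul = a from
      AddMonoidHom.ext fun a => congrArg Additive.ofMul (h a.toMul)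
    intro a
    rw [hpow]
    have hsp : s ^ p ∈ A := hAp ▸ A.pow_index_mem s
    refine Subtype.ext ?_
    rw [MulAut.conjNormal_apply,
      show s ^ p * (a : G) = a * s ^ p from congrArg Subtype.val (hA.is_comm.comm ⟨_, hsp⟩ a),
      mul_inv_cancel_right]
  have hTp : T ^ p = 0 := by
    obtain ⟨r, hr⟩ := (Commute.one_left T).exists_add_pow_prime_eq hp
    have h0 : (p : AddMonoid.End (Additive A)) = 0 := by
      suffices h : ∀ a : A, a ^ p = 1 from
        AddMonoidHom.ext fun a => congrArg Additive.ofMul (h a.toMul)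
      exact fun a => Subtype.ext (hexp a a.2)
    rw [hone, h0, one_pow, zero_mul, zero_mul, zero_mul, add_zero] at hr
    exact left_eq_add.1 hr
  have h1 := T.card_ker_pow_le p
  have h2 : AddMonoidHom.ker (T ^ p : AddMonoid.End (Additive A)) = ⊤ := by
    rw [hTp, eq_top_iff]
    exact fun x _ => rfl
  rw [h2, AddSubgroup.card_top] at h1
  exact h1.trans (Nat.pow_le_pow_left hker p)

theorem exists_isMulCommutative_centralizer_le (G : Type*) [Group G] [Finite G] :
    ∃ B : Subgroup G, IsMulCommutative B ∧ Subgroup.centralizer (B : Set G) ≤ B := by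
  obtain ⟨B, hB⟩ := (Set.toFinite {B : Subgroup G | IsMulCommutative B}).exists_maximal
    ⟨⊥, inferInstanceAs (IsMulCommutative (⊥ : Subgroup G))⟩
  refine ⟨B, hB.prop, fun g hg => ?_⟩
  have h1 : IsMulCommutative (Subgroup.closure ((B : Set G) ∪ {g})) := by
    refine Subgroup.isMulCommutative_closure ?_
    have hBB := Subgroup.le_centralizer_iff_isMulCommutative.2 hB.prop
    rintro a (ha | ha) b (hb | hb)
    · exact hBB hb a ha
    · rw [Set.mem_singleton_iff.1 hb]; exact hg a ha
    · rw [Set.mem_singleton_iff.1 ha]; exact (hg b hb).symm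
    · rw [Set.mem_singleton_iff.1 ha, Set.mem_singleton_iff.1 hb]
  have h2 : B ≤ Subgroup.closure ((B : Set G) ∪ {g}) := fun b hb =>
    Subgroup.subset_closure (Or.inl hb)
  exact hB.le_of_ge h1 h2 (Subgroup.subset_closure (Or.inr rfl))

open scoped IsMulCommutative in
/-- If the derived subgroup lies in a central subgroup of prime order, then some abelian subgroup
`B` containing the center has index at most `|B : Z(G)|`. -/
theorem exists_isMulCommutative_index_le_relIndex_center {p : ℕ} (hp : p.Prime) (Z : Subgroup G)
    (hZp : Nat.card Z = p) (hZ : Z ≤ Subgroup.center G) (hG : commutator G ≤ Z) :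
    ∃ B : Subgroup G, IsMulCommutative B ∧ Subgroup.center G ≤ B ∧
      B.index ≤ (Subgroup.center G).relIndex B := by
  obtain ⟨B, hB, hBc⟩ := exists_isMulCommutative_centralizer_le G
  have hcB : Subgroup.center G ≤ B := (Subgroup.center_le_centralizer _).trans hBc
  refine ⟨B, hB, hcB, ?_⟩
  have hmem : ∀ a b : G, ⁅a, b⁆ ∈ Z := fun a b =>
    hG (Subgroup.commutator_mem_commutator (Subgroup.mem_top a) (Subgroup.mem_top b))
  have hcen : ∀ a b c : G, c * ⁅a, b⁆ = ⁅a, b⁆ * c := fun a b c =>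
    Subgroup.mem_center_iff.1 (hZ (hmem a b)) c
  have hZc : IsMulCommutative Z := Subgroup.le_centralizer_iff_isMulCommutative.1
    (hZ.trans (Subgroup.center_le_centralizer _))
  obtain ⟨z, hz⟩ : ∃ z : Z, z ≠ 1 := by
    have : Nontrivial Z := Finite.one_lt_card_iff_nontrivial.1 (hZp ▸ hp.one_lt)
    exact exists_ne 1
  obtain ⟨χ, hχ⟩ := CommGroup.exists_apply_ne_one_of_hasEnoughRootsOfUnity Z ℂ hz
  have hχ1 : ∀ y : Z, χ y = 1 → y = 1 := by
    have h1 : χ.ker = ⊥ := by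
      have : Fact (Nat.card Z).Prime := ⟨hZp ▸ hp⟩
      refine (Subgroup.eq_bot_or_eq_top_of_prime_card χ.ker).resolve_right fun h => hχ ?_
      exact MonoidHom.mem_ker.1 (h ▸ Subgroup.mem_top z)
    intro y hy
    have : y ∈ χ.ker := hy
    rwa [h1, Subgroup.mem_bot] at this
  -- The commutator pairing of G with B, made complex-valued by a faithful character χ of Z. Its
  -- left kernel is the centralizer of B, which is B, and each `Ψ g` is trivial on the center. So
  -- G/B embeds in the dual of B/Z(G).
  let Ψ : G →* (B →* ℂˣ) :=
    { toFun := fun g =>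
        { toFun := fun b => χ ⟨⁅g, (b : G)⁆, hmem _ _⟩
          map_one' := by
            rw [← map_one χ]
            exact congrArg χ (Subtype.ext (commutatorElement_one_right g))
          map_mul' := fun a b => by
            rw [← map_mul]
            refine congrArg χ (Subtype.ext ?_)
            change ⁅g, (a * b : G)⁆ = ⁅g, (a : G)⁆ * ⁅g, (b : G)⁆
            rw [commutatorElement_mul_right_eq_mul_conj, mul_assoc ⁅g, (a : G)⁆, hcen g b a]
            simp [mul_assoc] }
      map_one' := by
        refine MonoidHom.ext fun b => ?_
        exact (congrArg χ (Subtype.ext (commutatorElement_one_left (b : G)))).trans (map_one χ)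
      map_mul' := fun a b => by
        ext c
        simp only [MonoidHom.mul_apply, MonoidHom.coe_mk, OneHom.coe_mk]
        rw [← map_mul]
        refine congrArg (fun y => ((χ y : ℂˣ) : ℂ)) (Subtype.ext ?_)
        change ⁅a * b, (c : G)⁆ = ⁅a, (c : G)⁆ * ⁅b, (c : G)⁆
        rw [commutatorElement_mul_left_eq_conj_mul, hcen b c a, mul_inv_cancel_right, hcen] }
  have hΨ : ∀ g (b : B), Ψ g b = χ ⟨⁅g, (b : G)⁆, hmem _ _⟩ := fun _ _ => rfl
  have hker : Ψ.ker = B := by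
    ext g
    constructor
    · intro hg
      refine hBc fun b hb => ?_
      have h1 := DFunLike.congr_fun (MonoidHom.mem_ker.1 hg) ⟨b, hb⟩
      have h2 := congrArg Subtype.val (hχ1 _ h1)
      exact (commutatorElement_eq_one_iff_mul_comm.1 h2).symm
    · intro hg
      refine MonoidHom.ext fun b => ?_
      rw [hΨ, MonoidHom.one_apply, ← map_one χ]
      refine congrArg χ (Subtype.ext (commutatorElement_eq_one_iff_mul_comm.2 ?_))
      exact congrArg Subtype.val (hB.is_comm.comm ⟨g, hg⟩ b)
  have hle : Ψ.range ≤ (MonoidHom.domRestrictHom ((Subgroup.center G).subgroupOf B) ℂˣ).ker := by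
    rintro _ ⟨g, rfl⟩
    refine MonoidHom.mem_ker.2 (MonoidHom.ext fun y => ?_)
    change Ψ g y = 1
    rw [hΨ, ← map_one χ]
    refine congrArg χ (Subtype.ext (commutatorElement_eq_one_iff_mul_comm.2 ?_))
    exact Subgroup.mem_center_iff.1 y.2 g
  have h1 := CommGroup.card_domRestrictHom_ker (M := ℂ) ((Subgroup.center G).subgroupOf B)
  rw [← Subgroup.index_eq_card] at h1
  calc B.index = Nat.card Ψ.range := by rw [← Subgroup.index_ker, hker]
    _ ≤ _ := Nat.card_mono (Set.toFinite _) hle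
    _ = _ := h1

/-- The bound on the index of an abelian subgroup when `G` has a maximal subgroup whose derived
subgroup is central of order dividing `p`. -/
theorem exists_isMulCommutative_index_eq_pow {p : ℕ} (hp : p.Prime) (hG : IsPGroup p G)
    (hindex : (commutator G).index ∣ p ^ 2) (Z A : Subgroup G) (hZp : Nat.card Z = p)
    (hZ : Z ≤ Subgroup.center G) (hZA : Z ≤ A) (hA : A.index = p) (hAZ : ⁅A, A⁆ ≤ Z) :
    ∃ (B : Subgroup G) (k : ℕ), IsMulCommutative B ∧ B.index = p ^ (k + 1) ∧ 2 * k ≤ p := by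
  have : Fact p.Prime := ⟨hp⟩
  have hAn : A.Normal := hG.normal_of_index_eq hp hA
  have hZc : Z.subgroupOf A ≤ Subgroup.center A := fun z hz =>
    Subgroup.mem_center_iff.2 fun a => Subtype.ext (Subgroup.mem_center_iff.1 (hZ hz) a)
  have hcard : Nat.card (Z.subgroupOf A) = p := by
    rw [← hZp]
    exact Nat.card_congr (Subgroup.subgroupOfEquivOfLe hZA).toEquiv
  have hcomm : commutator A ≤ Z.subgroupOf A := by
    rw [Subgroup.subgroupOf, ← Subgroup.map_le_iff_le_comap, Subgroup.map_subtype_commutator]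
    exact hAZ
  obtain ⟨B, hB, hcB, hBle⟩ :=
    exists_isMulCommutative_index_le_relIndex_center hp _ hcard hZc hcomm
  -- K is Z(A) viewed in G. The quotient A/K is abelian, and has exponent p because ⁅b, a ^ p⁆ = ⁅b,
  -- a⁆ ^ p = 1. The bound p ^ p therefore applies to it inside G/K.
  set K := (Subgroup.center A).map A.subtype with hK
  have hKA : K ≤ A := Subgroup.map_subtype_le _
  have hKn : K.Normal := inferInstance
  have hsurj := QuotientGroup.mk'_surjective K
  set Q := A.map (QuotientGroup.mk' K) with hQ
  have hQn : Q.Normal := hAn.map _ hsurj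
  have hmemK : ∀ a ∈ A, (∀ b ∈ A, b * a = a * b) → a ∈ K := fun a ha h =>
    ⟨⟨a, ha⟩, Subgroup.mem_center_iff.2 fun b => Subtype.ext (h b b.2), rfl⟩
  have hZK : Z ≤ K := fun z hz => hmemK z (hZA hz) fun b _ => Subgroup.mem_center_iff.1 (hZ hz) b
  have hAA : ∀ a ∈ A, ∀ b ∈ A, ⁅a, b⁆ ∈ Z := fun a ha b hb =>
    hAZ (Subgroup.commutator_mem_commutator ha hb)
  have hQcomm : IsMulCommutative Q := by
    rw [← Subgroup.le_centralizer_iff_isMulCommutative]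
    rintro _ ⟨a, ha, rfl⟩ _ ⟨b, hb, rfl⟩
    rw [← commutatorElement_eq_one_iff_mul_comm, ← map_commutatorElement, QuotientGroup.mk'_apply,
      QuotientGroup.eq_one_iff]
    exact hZK (hAA b hb a ha)
  have hQp : Q.index = p := by
    rw [hQ, Subgroup.index_map_eq A hsurj (by rwa [QuotientGroup.ker_mk']), hA]
  have hQexp : ∀ a ∈ Q, a ^ p = 1 := by
    rintro _ ⟨a, ha, rfl⟩
    rw [← map_pow, QuotientGroup.mk'_apply, QuotientGroup.eq_one_iff]
    refine hmemK _ (pow_mem ha p) fun b hb => ?_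
    have h1 : ∀ n : ℕ, b * a ^ n = ⁅b, a⁆ ^ n * (a ^ n * b) := by
      intro n
      have hc := Subgroup.mem_center_iff.1 (hZ (hAA b hb a ha))
      have hba : b * a = ⁅b, a⁆ * (a * b) := by simp [commutatorElement_def, mul_assoc]
      induction n with
      | zero => simp
      | succ n ih =>
        have hcn : a ^ n * ⁅b, a⁆ = ⁅b, a⁆ * a ^ n := hc _
        rw [pow_succ, ← mul_assoc, ih, mul_assoc, mul_assoc, hba, ← mul_assoc (a ^ n), hcn, pow_succ]
        simp only [mul_assoc]
    have h2 : ⁅b, a⁆ ^ p = 1 := by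
      have h3 := pow_card_eq_one' (x := (⟨⁅b, a⁆, hAA b hb a ha⟩ : Z))
      rw [hZp] at h3
      exact congrArg Subtype.val h3
    rw [h1, h2, one_mul]
  have hQindex : (commutator (G ⧸ K)).index ∣ p ^ 2 := by
    refine dvd_trans ?_ hindex
    have := Subgroup.index_map_dvd (commutator G) hsurj
    rwa [map_commutator_eq, MonoidHom.range_eq_top.2 hsurj, ← commutator_def] at this
  have hQcard := card_le_pow_of_index_commutator_dvd hp Q hQcomm hQp hQexp hQindex
  have hcenter : (Subgroup.center A).index ≤ p ^ p := by
    have h1 := Subgroup.relIndex_ker (QuotientGroup.mk' K) (K := A)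
    rw [QuotientGroup.ker_mk', ← hQ] at h1
    have h2 : K.relIndex A = (Subgroup.center A).index := by
      rw [Subgroup.relIndex, hK, Subgroup.subgroupOf,
        Subgroup.comap_map_eq_self_of_injective A.subtype_injective]
    rw [← h2, h1]
    exact hQcard
  obtain ⟨k, hk⟩ := (hG.to_subgroup A).index B
  refine ⟨B.map A.subtype, k, ?_, ?_, ?_⟩
  · infer_instance
  · rw [Subgroup.index_map_subtype, hk, hA, pow_succ]
  -- With |A : B| = p ^ k, this is |A : B|² ≤ |A : Z(A)| ≤ p ^ p. The extra factor p in the index of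
  -- B in G is |G : A|.
  · have h1 := Subgroup.relIndex_mul_index hcB
    rw [← Nat.pow_le_pow_iff_right hp.one_lt]
    calc p ^ (2 * k) = B.index * B.index := by rw [hk, two_mul, pow_add]
      _ ≤ (Subgroup.center A).relIndex B * B.index := Nat.mul_le_mul_right _ hBle
      _ ≤ p ^ p := h1.trans_le hcenter

end

/-! ### p-groups whose character degrees are at most p. -/

section

variable {G : Type*} [Group G]

theorem Subgroup.commutator_sup_le {M N P K : Subgroup G} [K.Normal] (hM : ⁅M, P⁆ ≤ K)
    (hN : ⁅N, P⁆ ≤ K) : ⁅M ⊔ N, P⁆ ≤ K := by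
  have key : ∀ L : Subgroup G, ⁅L, P⁆ ≤ K ↔ L ≤ (Subgroup.centralizer
      (P.map (QuotientGroup.mk' K) : Set (G ⧸ K))).comap (QuotientGroup.mk' K) := by
    intro L
    rw [← Subgroup.map_le_iff_le_comap, ← Subgroup.commutator_eq_bot_iff_le_centralizer,
      ← Subgroup.map_commutator, Subgroup.map_eq_bot_iff, QuotientGroup.ker_mk']
  rw [key] at hM hN ⊢
  exact sup_le hM hN

variable [Finite G]

/-- Two distinct maximal subgroups force |G : G'| = p² and meet in G'. The sets M \ G' are then
disjoint of size (p - 1)|G'| inside G \ G', of size (p² - 1)|G'|. -/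
theorem IsPGroup.card_index_eq_le {p : ℕ} (hp : p.Prime) (hG : IsPGroup p G)
    (hindex : (commutator G).index ∣ p ^ 2) : Nat.card {M : Subgroup G // M.index = p} ≤ p + 1 := by
  classical
  have : Fact p.Prime := ⟨hp⟩
  have hle : ∀ M : {M : Subgroup G // M.index = p}, commutator G ≤ M := fun M =>
    have := hG.normal_of_index_eq hp M.2
    commutator_le_of_index_prime hp M.2
  have heq : ∀ M N : {M : Subgroup G // M.index = p}, (M : Subgroup G) ≤ N → M = N := by
    intro M N h
    by_contra hne
    have h1 := Subgroup.eq_top_of_index_prime_of_lt hp M.2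
      (lt_of_le_of_ne h fun h => hne (Subtype.ext h))
    have h2 := N.2
    rw [h1, Subgroup.index_top] at h2
    exact hp.one_lt.ne h2
  obtain ⟨j, hj, hj'⟩ := (Nat.dvd_prime_pow hp).1 hindex
  by_cases hsub : Subsingleton {M : Subgroup G // M.index = p}
  · have := Finite.card_le_one_iff_subsingleton.2 hsub
    omega
  have hinf : ∀ M N : {M : Subgroup G // M.index = p}, M ≠ N →
      ((M : Subgroup G) ⊓ N : Subgroup G) ≤ commutator G ∧ (commutator G).index = p ^ 2 := by
    intro M N hne
    have h0 : commutator G ≤ (M : Subgroup G) ⊓ N := le_inf (hle M) (hle N)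
    have h1 : ((M : Subgroup G) ⊓ N : Subgroup G) < M :=
      lt_of_le_of_ne inf_le_left fun h => hne (heq M N (inf_eq_left.1 h))
    obtain ⟨i, hi⟩ := hG.index ((M : Subgroup G) ⊓ N)
    have h2 := Subgroup.index_strictAnti h1
    rw [M.2, hi] at h2
    have h3 : 1 < i := (Nat.pow_lt_pow_iff_right hp.one_lt).1 (by simpa using h2)
    have h4 := Subgroup.index_dvd_of_le h0
    rw [hi, hj', Nat.pow_dvd_pow_iff_le_right hp.one_lt] at h4
    have h5 : j = 2 := by omega
    have h6 : i = 2 := by omega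
    refine ⟨?_, by rw [hj', h5]⟩
    by_contra hlt
    have h7 := Subgroup.index_strictAnti (lt_of_le_of_ne h0 fun h => hlt h.ge)
    rw [hi, hj', h5, h6] at h7
    exact lt_irrefl _ h7
  have : Fintype G := Fintype.ofFinite G
  have : Fintype {M : Subgroup G // M.index = p} := Fintype.ofFinite _
  rw [not_subsingleton_iff_nontrivial] at hsub
  obtain ⟨M₀, N₀, hMN₀⟩ := hsub.exists_pair_ne
  have hidx := (hinf M₀ N₀ hMN₀).2
  let c := Nat.card (commutator G)
  have hcpos : 0 < c := Nat.card_pos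
  have hcard : Nat.card G = p ^ 2 * c := by rw [← hidx]; exact (Subgroup.index_mul_card _).symm
  let S : {M : Subgroup G // M.index = p} → Finset G := fun M =>
    Finset.univ.filter (· ∈ (M : Subgroup G)) \ Finset.univ.filter (· ∈ commutator G)
  have hfc : ∀ H : Subgroup G, (Finset.univ.filter (· ∈ H)).card = Nat.card H := fun H => by
    rw [Nat.card_eq_fintype_card, Fintype.card_subtype]
  have hMcard : ∀ M : {M : Subgroup G // M.index = p}, Nat.card (M : Subgroup G) = p * c := by
    intro M
    have h1 := (M : Subgroup G).index_mul_card
    rw [M.2, hcard, sq, mul_assoc] at h1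
    exact Nat.eq_of_mul_eq_mul_left hp.pos h1
  have hS : ∀ M, (S M).card = p * c - c := by
    intro M
    rw [Finset.card_sdiff_of_subset, hfc, hfc, hMcard]
    intro g hg
    simp only [Finset.mem_filter, Finset.mem_univ, true_and] at hg ⊢
    exact hle M hg
  have hdisj : ((Finset.univ : Finset {M : Subgroup G // M.index = p}) : Set _).PairwiseDisjoint S := by
    intro M _ N _ hne
    rw [Function.onFun, Finset.disjoint_left]
    intro g hg hg'
    simp only [S, Finset.mem_sdiff, Finset.mem_filter, Finset.mem_univ, true_and] at hg hg'
    exact hg.2 ((hinf M N hne).1 ⟨hg.1, hg'.1⟩)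
  have hsum := Finset.card_biUnion hdisj
  have hsub : Finset.univ.biUnion S ⊆ Finset.univ \ Finset.univ.filter (· ∈ commutator G) := by
    intro g hg
    simp only [S, Finset.mem_biUnion, Finset.mem_sdiff, Finset.mem_filter, Finset.mem_univ,
      true_and] at hg ⊢
    exact hg.choose_spec.2
  have h1 := Finset.card_le_card hsub
  rw [hsum, Finset.sum_congr rfl (fun M _ => hS M), Finset.sum_const, Finset.card_sdiff_of_subset
    (Finset.subset_univ _), hfc, Finset.card_univ, Finset.card_univ, smul_eq_mul,
    ← Nat.card_eq_fintype_card, ← Nat.card_eq_fintype_card, hcard] at h1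
  change _ * (p * c - c) ≤ p ^ 2 * c - c at h1
  have h2 : p ^ 2 * c - c = (p + 1) * (p * c - c) := by
    have h3 : p * c - c = (p - 1) * c := by rw [Nat.sub_mul, one_mul]
    obtain ⟨q, rfl⟩ : ∃ q, p = q + 1 := ⟨p - 1, (Nat.sub_add_cancel hp.pos).symm⟩
    rw [h3, Nat.add_sub_cancel]
    apply Nat.sub_eq_of_eq_add
    ring
  rw [h2] at h1
  refine Nat.le_of_mul_le_mul_right h1 (Nat.sub_pos_of_lt ?_)
  nlinarith [hp.two_le]

/-- Finitely many, at most `p`, nontrivial elements of an abelian `p`-group are all detected by a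
single character. -/
theorem IsPGroup.exists_monoidHom_forall_apply_ne_one {A : Type*} [CommGroup A] [Finite A] {p : ℕ}
    (hp : p.Prime) (hA : IsPGroup p A) (S : Finset A) (hS : S.card ≤ p) (h1 : 1 ∉ S) :
    ∃ χ : A →* ℂˣ, ∀ z ∈ S, χ z ≠ 1 := by
  classical
  have : Fact p.Prime := ⟨hp⟩
  have hX : Nat.card (A →* ℂˣ) = Nat.card A := CommGroup.card_monoidHom_of_hasEnoughRootsOfUnity A ℂ
  have hfin : Finite (A →* ℂˣ) := Nat.finite_of_card_ne_zero (hX ▸ Nat.card_pos.ne')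
  have : Fintype (A →* ℂˣ) := Fintype.ofFinite _
  obtain ⟨n, hn⟩ := IsPGroup.iff_card.1 hA
  have hXp : IsPGroup p (A →* ℂˣ) := IsPGroup.of_card (hX.trans hn)
  by_contra! hcov
  -- The annihilator of z ∈ S is a proper subgroup of the dual, of order at most |A|/p. At most p of
  -- these, all sharing the trivial character, cover at most |A| - p + 1 < |A| characters.
  let W : A → Subgroup (A →* ℂˣ) := fun z => (MonoidHom.eval z).ker
  have hW : ∀ z χ, χ ∈ W z ↔ χ z = 1 := fun z χ => Iff.rfl
  have hWcard : ∀ z ∈ S, p * Nat.card (W z) ≤ Nat.card A := by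
    intro z hz
    obtain ⟨χ, hχ⟩ := CommGroup.exists_apply_ne_one_of_hasEnoughRootsOfUnity A ℂ
      (a := z) (fun h => h1 (h ▸ hz))
    obtain ⟨k, hk⟩ := hXp.index (W z)
    have hk0 : k ≠ 0 := by
      rintro rfl
      rw [pow_zero, Subgroup.index_eq_one] at hk
      exact hχ ((hW z χ).1 (hk ▸ Subgroup.mem_top χ))
    rw [← hX, ← (W z).index_mul_card, hk]
    exact Nat.mul_le_mul_right _ (Nat.le_self_pow hk0 p)
  let T : A → Finset (A →* ℂˣ) := fun z => (Finset.univ.filter (· ∈ W z)).erase 1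
  have hT : ∀ z, (T z).card = Nat.card (W z) - 1 := by
    intro z
    rw [Finset.card_erase_of_mem (by simp [one_mem]), Nat.card_eq_fintype_card, Fintype.card_subtype]
  have hsub : (Finset.univ : Finset (A →* ℂˣ)).erase 1 ⊆ S.biUnion T := by
    intro χ hχ
    obtain ⟨z, hz, hχz⟩ := hcov χ
    exact Finset.mem_biUnion.2 ⟨z, hz, Finset.mem_erase.2 ⟨Finset.ne_of_mem_erase hχ,
      Finset.mem_filter.2 ⟨Finset.mem_univ _, hχz⟩⟩⟩
  have h2 := (Finset.card_le_card hsub).trans Finset.card_biUnion_le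
  rw [Finset.card_erase_of_mem (Finset.mem_univ _), Finset.card_univ, ← Nat.card_eq_fintype_card,
    hX, Finset.sum_congr rfl (fun z _ => hT z)] at h2
  rcases S.eq_empty_or_nonempty with rfl | hne
  · obtain ⟨z, hz, -⟩ := hcov 1
    simp at hz
  have h3 : p * ∑ z ∈ S, (Nat.card (W z) - 1) ≤ p * (Nat.card A - p) := by
    calc p * ∑ z ∈ S, (Nat.card (W z) - 1) = ∑ z ∈ S, (p * Nat.card (W z) - p) := by
          rw [Finset.mul_sum]
          exact Finset.sum_congr rfl fun z _ => by rw [Nat.mul_sub, mul_one]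
      _ ≤ ∑ z ∈ S, (Nat.card A - p) :=
          Finset.sum_le_sum fun z hz => Nat.sub_le_sub_right (hWcard z hz) p
      _ ≤ p * (Nat.card A - p) := by
          rw [Finset.sum_const, smul_eq_mul]
          exact Nat.mul_le_mul_right _ hS
  have h4 := h2.trans (Nat.le_of_mul_le_mul_left h3 hp.pos)
  obtain ⟨z, hz⟩ := hne
  have h5 := hWcard z hz
  have h6 : 0 < Nat.card (W z) := Nat.card_pos
  have := hp.two_le
  -- Ensures p ≤ |A|, so that the subtraction in `Nat.card A - p` is not truncated.
  have : p ≤ p * Nat.card (W z) := Nat.le_mul_of_pos_right p h6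
  omega

open scoped IsMulCommutative in
/-- A `p`-group with abelianization of order dividing `p ^ 2` and character degrees at most `p`
either has an abelian maximal subgroup or has class at most `3`. -/
theorem commutator_commutator_le_center_of_degrees_le {p : ℕ} (hp : p.Prime) (hG : IsPGroup p G)
    (hindex : (commutator G).index ∣ p ^ 2) (hdeg : ∀ n ∈ irreducibleCharacterDegrees G, n ≤ p)
    (hab : ∀ M : Subgroup G, M.index = p → ¬ IsMulCommutative M) [Nontrivial G] :
    ⁅(⊤ : Subgroup G), commutator G⁆ ≤ Subgroup.center G := by
  classical
  have hn : ∀ M : {M : Subgroup G // M.index = p}, (M : Subgroup G).Normal := fun M =>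
    hG.normal_of_index_eq hp M.2
  let D : {M : Subgroup G // M.index = p} → Subgroup G := fun M => ⁅(M : Subgroup G), M⁆
  have hDn : ∀ M, (D M).Normal := fun M => inferInstance
  have hle : ∀ M : {M : Subgroup G // M.index = p}, commutator G ≤ M := fun M =>
    have := hn M
    commutator_le_of_index_prime hp M.2
  -- Choose a nontrivial central z M in each M'. If these were at most p elements, some central
  -- character would be nontrivial on all of them. An irreducible representation above it has degree
  -- at most p, so it kills some M' and hence z M, a contradiction. With at most p + 1 maximal
  -- subgroups, every such choice is injective.
  have hchoice : ∀ z : {M : Subgroup G // M.index = p} → Subgroup.center G,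
      (∀ M, (z M : G) ∈ D M ∧ z M ≠ 1) →
        p + 1 ≤ Nat.card {M : Subgroup G // M.index = p} ∧ Function.Injective z := by
    intro z hz
    have : Fintype {M : Subgroup G // M.index = p} := Fintype.ofFinite _
    have himg : p < (Finset.univ.image z).card := by
      by_contra! hcard
      obtain ⟨χ, hχ⟩ := IsPGroup.exists_monoidHom_forall_apply_ne_one hp
        (hG.to_subgroup (Subgroup.center G)) (Finset.univ.image z) hcard (by
          intro h
          obtain ⟨M, -, hM⟩ := Finset.mem_image.1 h
          exact (hz M).2 hM)
      obtain ⟨V, _, _, _, ρ, hρ, hρz⟩ := exists_isIrreducible_forall_center_apply_eq χ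
      have hdim := hdeg _ (mem_irreducibleCharacterDegrees_of_isIrreducible ρ hρ)
      obtain ⟨M, hM, hMc⟩ := exists_index_eq_forall_commutator_apply_eq_one hp hG ρ hρ hdim
      have hker : D ⟨M, hM⟩ ≤ MonoidHom.ker ρ := by
        rw [Subgroup.commutator_le]
        intro a ha b hb
        have h1 : a * b = ⁅a, b⁆ * (b * a) := by simp [commutatorElement_def, mul_assoc]
        have h2 : ρ (a * b) * ρ (b * a)⁻¹ = ρ ⁅a, b⁆ := by
          rw [h1, map_mul, mul_assoc, ← map_mul, mul_inv_cancel, map_one, mul_one]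
        rw [MonoidHom.mem_ker, ← h2, map_mul, (hMc a ha b hb).eq, ← map_mul, ← map_mul,
          mul_inv_cancel, map_one]
      have h1 := MonoidHom.mem_ker.1 (hker (hz ⟨M, hM⟩).1)
      rw [hρz] at h1
      apply hχ _ (Finset.mem_image_of_mem z (Finset.mem_univ ⟨M, hM⟩))
      have hV := ((isIrreducible_iff_forall_submodule ρ).1 hρ).1
      obtain ⟨v, hv⟩ := exists_ne (0 : V)
      have h2 := LinearMap.congr_fun h1 v
      refine Units.ext (smul_left_injective ℂ hv ?_)
      simpa using h2
    have hcard := IsPGroup.card_index_eq_le hp hG hindex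
    have h1 : (Finset.univ.image z).card ≤ Fintype.card {M : Subgroup G // M.index = p} :=
      Finset.card_image_le
    rw [Nat.card_eq_fintype_card] at hcard ⊢
    refine ⟨by omega, ?_⟩
    rw [← Set.injOn_univ, ← Finset.coe_univ, ← Finset.card_image_iff, Finset.card_univ]
    omega
  have hDne : ∀ M, D M ≠ ⊥ := fun M h => hab M M.2 (Subgroup.commutator_self_eq_bot_iff.1 h)
  have hz₀ : ∀ M, ∃ z : Subgroup.center G, (z : G) ∈ D M ∧ z ≠ 1 := by
    intro M
    obtain ⟨z, hzD, hzc, hz⟩ := hG.exists_mem_center_of_normal hp (D M) (hDne M)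
    refine ⟨⟨z, hzc⟩, hzD, fun h => ?_⟩
    rw [show z = 1 from congrArg Subtype.val h, orderOf_one] at hz
    exact hp.one_lt.ne hz
  choose z₀ hz₀ using hz₀
  -- A nontrivial intersection would allow the same central element to be chosen for M and N.
  have hdisj : ∀ M N, M ≠ N → D M ⊓ D N = ⊥ := by
    intro M N hne
    by_contra h
    obtain ⟨w, hwD, hwc, hw⟩ := hG.exists_mem_center_of_normal hp (D M ⊓ D N) h
    have hw1 : (⟨w, hwc⟩ : Subgroup.center G) ≠ 1 := by
      intro h
      rw [show w = 1 from congrArg Subtype.val h, orderOf_one] at hw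
      exact hp.one_lt.ne hw
    refine hne ((hchoice (fun X => if X = M ∨ X = N then ⟨w, hwc⟩ else z₀ X) fun X => ?_).2 ?_)
    · by_cases hX : X = M ∨ X = N
      · simp only [hX, if_true]
        rcases hX with rfl | rfl
        · exact ⟨hwD.1, hw1⟩
        · exact ⟨hwD.2, hw1⟩
      · simp only [hX, if_false]
        exact hz₀ X
    · simp
  have hsup : ∀ M N : {M : Subgroup G // M.index = p}, M ≠ N → (M : Subgroup G) ⊔ N = ⊤ := by
    intro M N hne
    have hlt : (M : Subgroup G) < (M : Subgroup G) ⊔ N ∨ (N : Subgroup G) < (M : Subgroup G) ⊔ N := by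
      by_contra! h
      have h1 : (M : Subgroup G) = (M : Subgroup G) ⊔ N := le_sup_left.eq_of_not_lt h.1
      have h2 : (N : Subgroup G) = (M : Subgroup G) ⊔ N := le_sup_right.eq_of_not_lt h.2
      exact hne (Subtype.ext (h1.trans h2.symm))
    rcases hlt with h | h
    · exact Subgroup.eq_top_of_index_prime_of_lt hp M.2 h
    · exact Subgroup.eq_top_of_index_prime_of_lt hp N.2 h
  have hcent : ∀ L M N : {M : Subgroup G // M.index = p}, L ≠ M → L ≠ N → M ≠ N →
      D L ≤ Subgroup.center G := by
    intro L M N hLM hLN hMN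
    -- Since D L ≤ G' ≤ X, this commutator lies in both D X and D L. Two maximal subgroups other
    -- than L generate G, so D L is central.
    have key : ∀ X, L ≠ X → ⁅(X : Subgroup G), D L⁆ = ⊥ := by
      intro X hX
      rw [eq_bot_iff, ← hdisj L X hX]
      refine le_inf (Subgroup.commutator_le_right _ _) (Subgroup.commutator_mono le_rfl ?_)
      exact (Subgroup.commutator_mono le_top le_top).trans (hle X)
    rw [← Subgroup.commutator_top_left_eq_bot_iff_le_center, ← hsup M N hMN, eq_bot_iff]
    exact Subgroup.commutator_sup_le (key M hLM).le (key N hLN).le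
  have hcard : 2 < Nat.card {M : Subgroup G // M.index = p} := by
    have := (hchoice z₀ hz₀).1
    have := hp.two_le
    omega
  have : Fintype {M : Subgroup G // M.index = p} := Fintype.ofFinite _
  rw [Nat.card_eq_fintype_card, Fintype.two_lt_card_iff] at hcard
  obtain ⟨L, M, N, hLM, hLN, hMN⟩ := hcard
  -- ⁅L, G'⁆ ≤ ⁅L, L⁆ = D L is central, and likewise for M, while L and M generate G.
  rw [← hsup L M hLM]
  exact Subgroup.commutator_sup_le
    ((Subgroup.commutator_mono le_rfl (hle L)).trans (hcent L M N hLM hLN hMN))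
    ((Subgroup.commutator_mono le_rfl (hle M)).trans (hcent M L N hLM.symm hMN hLN))

/-- If x and y do not commute, then G'⟨x⟩ lies strictly between G' and G, so it has index p and G =
G'⟨x, y⟩. As G' is central, ⁅x, y⁆ generates G'. -/
theorem exists_commutator_le_zpowers {p : ℕ} (hp : p.Prime) (hindex : (commutator G).index ∣ p ^ 2)
    (hc : commutator G ≤ Subgroup.center G) : ∃ t ∈ commutator G, commutator G ≤ Subgroup.zpowers t := by
  by_cases hcomm : ∀ x y : G, x * y = y * x
  · refine ⟨1, one_mem _, ?_⟩
    rw [commutator_def, Subgroup.commutator_le]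
    intro a _ b _
    rw [commutatorElement_eq_one_iff_mul_comm.2 (hcomm a b)]
    exact one_mem _
  push Not at hcomm
  obtain ⟨x, y, hxy⟩ := hcomm
  have ht : ⁅x, y⁆ ∈ commutator G :=
    Subgroup.commutator_mem_commutator (Subgroup.mem_top x) (Subgroup.mem_top y)
  have hn : (Subgroup.zpowers ⁅x, y⁆).Normal :=
    Subgroup.normal_of_le_center (Subgroup.zpowers_le.2 (hc ht))
  refine ⟨_, ht, ?_⟩
  set E := commutator G ⊔ Subgroup.zpowers x with hE
  have hyE : y ∉ E := by
    have hEC : E ≤ Subgroup.centralizer {x} := by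
      refine sup_le (hc.trans (Subgroup.center_le_centralizer _)) (Subgroup.zpowers_le.2 ?_)
      exact Subgroup.mem_centralizer_singleton_iff.2 rfl
    intro h
    exact hxy (Subgroup.mem_centralizer_singleton_iff.1 (hEC h)).symm
  have hxG : x ∉ commutator G := fun h => hxy (Subgroup.mem_center_iff.1 (hc h) y).symm
  have hlt : commutator G < E := lt_of_le_of_ne le_sup_left fun h => hxG <| by
    rw [h]; exact Subgroup.mem_sup_right (Subgroup.mem_zpowers x)
  have hEp : E.index = p := by
    have h1 := (Subgroup.index_dvd_of_le hlt.le).trans hindex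
    obtain ⟨j, hj, hj'⟩ := (Nat.dvd_prime_pow hp).1 h1
    have h2 := (Subgroup.index_strictAnti hlt).trans_le (Nat.le_of_dvd (pow_pos hp.pos 2) hindex)
    rw [hj', Nat.pow_lt_pow_iff_right hp.one_lt] at h2
    have h3 : j ≠ 0 := by
      rintro rfl
      rw [pow_zero, Subgroup.index_eq_one] at hj'
      exact hyE (hj' ▸ Subgroup.mem_top y)
    rw [hj', show j = 1 by omega, pow_one]
  have htop := Subgroup.sup_zpowers_eq_top_of_index_prime hp hEp hyE
  have hcen : ∀ a ∈ commutator G, ∀ b : G, ⁅a, b⁆ = 1 := fun a ha b =>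
    commutatorElement_eq_one_iff_mul_comm.2 (Subgroup.mem_center_iff.1 (hc ha) b).symm
  refine commutator_le_of_closure_eq_top (S := commutator G ∪ {x} ∪ {y}) ?_ ?_
  · rw [Subgroup.closure_union, Subgroup.closure_union, Subgroup.closure_eq,
      ← Subgroup.zpowers_eq_closure, ← Subgroup.zpowers_eq_closure, htop]
  · rintro a ((ha | ha) | ha) b ((hb | hb) | hb)
    all_goals first
      | (rw [hcen a ha]; exact one_mem _)
      | (rw [← commutatorElement_inv b a, hcen b hb, inv_one]; exact one_mem _)
      | skip
    all_goals rw [Set.mem_singleton_iff.1 ha, Set.mem_singleton_iff.1 hb]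
    · rw [commutatorElement_self]; exact one_mem _
    · exact Subgroup.mem_zpowers _
    · rw [← commutatorElement_inv x y]; exact inv_mem (Subgroup.mem_zpowers _)
    · rw [commutatorElement_self]; exact one_mem _

/-- Here ⁅G, C⁆ ≤ Z is central for C = ⁅G, G'⁆, so the three subgroups lemma gives ⁅G', C⁆ = 1.
Since G/C has class at most 2, G'/C is cyclic. A group that is cyclic modulo a central subgroup is
abelian. -/
theorem isMulCommutative_commutator_of_commutator_quotient_le_center {p : ℕ} (hp : p.Prime)
    (hindex : (commutator G).index ∣ p ^ 2) (Z : Subgroup G) [Z.Normal] (hZ : Z ≤ Subgroup.center G)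
    (h : ⁅(⊤ : Subgroup (G ⧸ Z)), commutator (G ⧸ Z)⁆ ≤ Subgroup.center (G ⧸ Z)) :
    IsMulCommutative (commutator G) := by
  have hsurj := QuotientGroup.mk'_surjective Z
  have hmaptop : (⊤ : Subgroup G).map (QuotientGroup.mk' Z) = ⊤ :=
    Subgroup.map_top_of_surjective _ hsurj
  set C := ⁅(⊤ : Subgroup G), commutator G⁆ with hC
  have hCle : C ≤ commutator G := Subgroup.commutator_mono le_rfl le_top
  have h1 : ⁅(⊤ : Subgroup G), C⁆ ≤ Z := by
    have h2 : (⁅(⊤ : Subgroup G), C⁆).map (QuotientGroup.mk' Z) = ⊥ := by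
      rw [Subgroup.map_commutator, hC, Subgroup.map_commutator, commutator_def,
        Subgroup.map_commutator, hmaptop, ← commutator_def,
        Subgroup.commutator_top_left_eq_bot_iff_le_center]
      exact h
    rwa [Subgroup.map_eq_bot_iff, QuotientGroup.ker_mk'] at h2
  have h3 : ⁅commutator G, C⁆ = ⊥ := by
    rw [commutator_def]
    apply Subgroup.commutator_commutator_eq_bot_of_rotate
    · rw [Subgroup.commutator_top_right_eq_bot_iff_le_center]
      exact h1.trans hZ
    · rw [Subgroup.commutator_comm C, Subgroup.commutator_top_right_eq_bot_iff_le_center]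
      exact h1.trans hZ
  have hsC := QuotientGroup.mk'_surjective C
  have hmapC : (commutator G).map (QuotientGroup.mk' C) = commutator (G ⧸ C) := by
    rw [map_commutator_eq, MonoidHom.range_eq_top.2 hsC, ← commutator_def]
  obtain ⟨t', ht', hle⟩ := exists_commutator_le_zpowers (G := G ⧸ C) hp (by
    refine dvd_trans ?_ hindex
    have := Subgroup.index_map_dvd (commutator G) hsC
    rwa [hmapC] at this) (by
    rw [← Subgroup.commutator_top_left_eq_bot_iff_le_center, ← hmapC,
      ← Subgroup.map_top_of_surjective _ hsC, ← Subgroup.map_commutator, Subgroup.map_eq_bot_iff,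
      QuotientGroup.ker_mk'])
  rw [← hmapC] at ht' hle
  obtain ⟨t, ht, rfl⟩ := ht'
  have hmem : ∀ a ∈ commutator G, ∃ k : ℤ, ∃ c ∈ C, a = t ^ k * c := by
    intro a ha
    obtain ⟨k, hk⟩ := hle (Subgroup.mem_map_of_mem (QuotientGroup.mk' C) ha)
    refine ⟨k, (t ^ k)⁻¹ * a, QuotientGroup.eq.1 hk, by group⟩
  rw [Subgroup.commutator_eq_bot_iff_le_centralizer] at h3
  have hcom : ∀ a ∈ commutator G, ∀ c ∈ C, Commute a c := fun a ha c hc => (h3 ha c hc).symm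
  rw [← Subgroup.le_centralizer_iff_isMulCommutative]
  intro a ha b hb
  obtain ⟨k, c, hcC, rfl⟩ := hmem a ha
  obtain ⟨m, d, hdC, rfl⟩ := hmem b hb
  have htz : ∀ i : ℤ, t ^ i ∈ commutator G := fun i => zpow_mem ht i
  exact (((Commute.refl t).zpow_zpow m k).mul_right (hcom _ (htz m) c hcC)).mul_left
    (((hcom _ (htz k) d hdC).symm).mul_right (hcom d (hCle hdC) c hcC))

end

/-! ### The induction on the order of the group. -/

theorem exists_irreducibleCharacterDegree_le_rpow {G : Type*} [Group G] [Finite G] {p : ℕ}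
    (hp : p.Prime) (hG : IsPGroup p G) (hindex : (commutator G).index ∣ p ^ 2)
    (hdeg : ∃ n ∈ irreducibleCharacterDegrees G, p < n) :
    ∃ n ∈ irreducibleCharacterDegrees G,
      p < n ∧ (n : ℝ) ≤ (p : ℝ) ^ (((p : ℝ) + 1) / 2) := by
  induction hm : Nat.card G using Nat.strong_induction_on generalizing G with
  | _ m ih =>
  subst hm
  obtain ⟨n, hn, hpn⟩ := hdeg
  have hbound : ∀ k : ℕ, 2 * k ≤ p + 1 → n ≤ p ^ k →
      (n : ℝ) ≤ (p : ℝ) ^ (((p : ℝ) + 1) / 2) := by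
    intro k hk hnk
    have h1 : (n : ℝ) ≤ (p : ℝ) ^ (k : ℝ) := by
      rw [Real.rpow_natCast]
      exact_mod_cast hnk
    refine h1.trans (Real.rpow_le_rpow_of_exponent_le (by exact_mod_cast hp.one_le) ?_)
    have h2 : (2 * k : ℝ) ≤ p + 1 := by exact_mod_cast hk
    linarith
  have hbot : commutator G ≠ ⊥ := by
    intro h
    have h1 := le_index_of_mem_irreducibleCharacterDegrees hn ⊤ (by
      rw [← Subgroup.commutator_self_eq_bot_iff, ← commutator_def, h])
    rw [Subgroup.index_top] at h1
    have := hp.two_le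
    omega
  have hp2 : p ≠ 2 := by
    rintro rfl
    obtain ⟨x, hx⟩ := hG.exists_zpowers_index_le_two hindex
    have := le_index_of_mem_irreducibleCharacterDegrees hn (Subgroup.zpowers x) inferInstance
    omega
  have hodd : Odd p := hp.odd_of_ne_two hp2
  obtain ⟨z, hzG, hzc, hzp⟩ := hG.exists_mem_center_of_normal hp (commutator G) hbot
  set Z := Subgroup.zpowers z with hZ
  have hZc : Z ≤ Subgroup.center G := Subgroup.zpowers_le.2 hzc
  have hZp : Nat.card Z = p := by rw [Nat.card_zpowers, hzp]
  have hZn : Z.Normal := Subgroup.normal_of_le_center hZc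
  have hsurj := QuotientGroup.mk'_surjective Z
  have hlt : Nat.card (G ⧸ Z) < Nat.card G := by
    rw [← Subgroup.index_eq_card, ← Z.index_mul_card, hZp]
    exact lt_mul_of_one_lt_right (Nat.pos_of_ne_zero Subgroup.index_ne_zero_of_finite) hp.one_lt
  have hQindex : (commutator (G ⧸ Z)).index ∣ p ^ 2 := by
    refine dvd_trans ?_ hindex
    have := Subgroup.index_map_dvd (commutator G) hsurj
    rwa [map_commutator_eq, MonoidHom.range_eq_top.2 hsurj, ← commutator_def] at this
  by_cases hQ : ∃ n ∈ irreducibleCharacterDegrees (G ⧸ Z), p < n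
  · obtain ⟨k, hk, h⟩ := ih _ hlt (hG.to_quotient Z) hQindex hQ rfl
    exact ⟨k, irreducibleCharacterDegrees_subset_of_surjective _ hsurj hk, h⟩
  push Not at hQ
  -- From here on the given degree n itself satisfies the bound, through the index of an abelian
  -- subgroup.
  refine ⟨n, hn, hpn, ?_⟩
  by_cases hab : ∃ M : Subgroup (G ⧸ Z), M.index = p ∧ IsMulCommutative M
  · obtain ⟨M, hM, hMc⟩ := hab
    have hZM : Z ≤ M.comap (QuotientGroup.mk' Z) := by
      simpa using Subgroup.ker_le_comap (QuotientGroup.mk' Z) M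
    obtain ⟨B, k, hB, hBk, hk⟩ := exists_isMulCommutative_index_eq_pow hp hG hindex Z
      (M.comap (QuotientGroup.mk' Z)) hZp hZc hZM
      (by rw [Subgroup.index_comap_of_surjective _ hsurj, hM]) (by
        rw [Subgroup.commutator_le]
        intro a ha b hb
        rw [← QuotientGroup.eq_one_iff, ← QuotientGroup.mk'_apply, map_commutatorElement,
          commutatorElement_eq_one_iff_mul_comm]
        exact congrArg Subtype.val (hMc.is_comm.comm ⟨_, ha⟩ ⟨_, hb⟩))
    -- As p is odd, 2k ≤ p improves to 2k ≤ p - 1, that is 2(k + 1) ≤ p + 1.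
    refine hbound (k + 1) ?_ (hBk ▸ le_index_of_mem_irreducibleCharacterDegrees hn B hB)
    obtain ⟨j, hj⟩ := hodd
    omega
  · push Not at hab
    have hQnt : Nontrivial (G ⧸ Z) := by
      rw [QuotientGroup.nontrivial_iff]
      intro h
      apply hbot
      rw [commutator_eq_bot_iff_center_eq_top]
      exact top_le_iff.1 (h ▸ hZc)
    have hc := commutator_commutator_le_center_of_degrees_le hp (hG.to_quotient Z) hQindex hQ hab
    have hGc := isMulCommutative_commutator_of_commutator_quotient_le_center hp hindex Z hZc hc
    -- The exponent 2 is allowed because p ≥ 3.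
    refine hbound 2 ?_ ((le_index_of_mem_irreducibleCharacterDegrees hn _ hGc).trans
      (Nat.le_of_dvd (pow_pos hp.pos 2) hindex))
    have := hp.two_le
    omega

theorem theorem1 {G : Type*} [Group G] [Finite G] (p : ℕ) (hp : p.Prime) (hG : IsPGroup p G)
    (hindex : (commutator G).index = p ^ 2)
    (hdeg : ∃ n ∈ irreducibleCharacterDegrees G, p < n) :
    ∃ n ∈ irreducibleCharacterDegrees G,
      p < n ∧ (n : ℝ) ≤ (p : ℝ) ^ (((p : ℝ) + 1) / 2) :=
  exists_irreducibleCharacterDegree_le_rpow hp hG hindex.dvd hdeg
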